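/- Let $X$ be a simply connected smooth surface (Hausdorff, second countable) with a smooth Lorentzian metric $g=\langle\cdot,\cdot\rangle$ and a complete Killing field $K$ (the generator of a one-parameter group of isometries). Assume that $X$ is null complete: every null geodesic extends to a geodesic defined on $\mathbb R$. Let $\mathbf x\colon X\to\mathbb R$ be the transverse coordinate of $(X,K)$, that is, a smooth function with $d\mathbf x=\pm\, i_K\nu$, where $\nu$ is the area form of $g$, equivalently $d\mathbf x(v)^2=\langle K,v\rangle^2-\langle K,K\rangle\langle v,v\rangle$ for all tangent vectors $v$; it is unique up to translation and change of sign. A ribbon is an open, simply connected, $K$-saturated subset of $X$ on which $K$ does not vanish and in which one of the two null foliations is everywhere transverse to $K$. Let $R_f$ be a maximal ribbon, and let $f\colon\mathbb R\to\mathbb R$ be the norm of $K$ read in the transverse coordinate, $\langle K,K\rangle=f\circ\mathbf x$ on $R_f$ (so that the metric of $R_f$ reads $2\,dx\,dy+f(x)\,dy^2$ with $K=\pm\partial_y$). Let $\varepsilon=\pm1$. Consider the maximal geodesics $\gamma$ of type $\varepsilon$ (spacelike if $\varepsilon=1$, timelike if $\varepsilon=-1$) which are contained in $R_f$ after a certain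 while, say for $t\in[t_0,t_\infty^+)$, where $t_\infty^+\in\mathbb R\cup\{\infty\}$ is the upper bound of the domain of $\gamma$, and for which $I^+=\{\mathbf x(\gamma(t)) : t_0\le t<t_\infty^+\}$ is unbounded above (that is, $I^+$ is unbounded, and the sign of $\mathbf x$ is chosen so that $\mathbf x$ increases along $\gamma$ after a certain while). Call $\gamma$ complete (towards the future) if $t_\infty^+=\infty$. Let $\mu$ be the Lebesgue measure and $\mathbb R^+=[0,\infty)$. 1. If $-\varepsilon f$ is bounded below and unbounded above on $\mathbb R$, then all these geodesics are complete if and only if - either there is $M>0$ with $\mu(\{-\varepsilon f\le M\}\cap\mathbb R^+)=\infty$, - or $\mu(\{-\varepsilon f\le M\}\cap\mathbb R^+)<\infty$ for all $M>0$, and there is $\alpha>0$ with $$\int_{\{-\varepsilon f\ge\alpha\}\cap\mathbb R^+}\frac{dx}{\sqrt{-\varepsilon f(x)}}=\infty .$$ 2. If $f$ is bounded, then all these geodesics are complete. -/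

import Mathlib

open Set Manifold MeasureTheory
open scoped ContDiff

/-- The plane, on which surfaces are modelled. -/
abbrev Plane : Type := EuclideanSpace ℝ (Fin 2)

/-- A smooth Lorentzian metric on a smooth surface: a smooth field of symmetric bilinear forms on
the (two-dimensional) tangent planes, each of which takes negative and positive values, that is,
each of which has signature `(1, 1)`. -/
structure LorentzianMetric (X : Type*) [TopologicalSpace X] [ChartedSpace Plane X]
    [IsManifold (𝓡 2) ∞ X] where
  /-- The bilinear form on the tangent plane at `p`. -/
  val (p : X) : TangentSpace (𝓡 2) p →L[ℝ] TangentSpace (𝓡 2) p →L[ℝ] ℝ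
  symm (p : X) (v w : TangentSpace (𝓡 2) p) : val p v w = val p w v
  exists_neg (p : X) : ∃ v : TangentSpace (𝓡 2) p, val p v v < 0
  exists_pos (p : X) : ∃ v : TangentSpace (𝓡 2) p, 0 < val p v v
  contMDiff : ContMDiff (𝓡 2) ((𝓡 2).prod 𝓘(ℝ, Plane →L[ℝ] Plane →L[ℝ] ℝ)) ∞
    (fun p ↦ Bundle.TotalSpace.mk' (Plane →L[ℝ] Plane →L[ℝ] ℝ)
      (E := fun p : X ↦ TangentSpace (𝓡 2) p →L[ℝ] TangentSpace (𝓡 2) p →L[ℝ] ℝ) p (val p))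

section Surface

variable {X : Type*} [TopologicalSpace X] [ChartedSpace Plane X] [IsManifold (𝓡 2) ∞ X]

/-- The velocity of a curve. -/
noncomputable def velocity (γ : ℝ → X) (t : ℝ) : TangentSpace (𝓡 2) (γ t) :=
  mfderiv 𝓘(ℝ, ℝ) (𝓡 2) γ t (1 : ℝ)

/-- The number `⟨γ', γ'⟩` at time `t`. -/
noncomputable def normSqVelocity (g : LorentzianMetric X) (γ : ℝ → X) (t : ℝ) : ℝ :=
  g.val (γ t) (velocity γ t) (velocity γ t)

/-- The metric in the coordinates of the chart at `p`: `coordMetric g p z a b = ∑ g_ij(z) aⁱ bʲ`. -/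
noncomputable def coordMetric (g : LorentzianMetric X) (p : X) (z a b : Plane) : ℝ :=
  g.val ((extChartAt (𝓡 2) p).symm z)
    (mfderiv 𝓘(ℝ, Plane) (𝓡 2) (extChartAt (𝓡 2) p).symm z a)
    (mfderiv 𝓘(ℝ, Plane) (𝓡 2) (extChartAt (𝓡 2) p).symm z b)

/-- The geodesic equation at time `t`, in the coordinates `u` of the chart at `γ t`:
`g_lk (u''ˡ + Γˡ_ij u'ⁱ u'ʲ) = 0` for all `k`, where
`g_lk Γˡ_ij = (∂_i g_jk + ∂_j g_ik - ∂_k g_ij) / 2`; it is contracted here with an arbitrary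
vector `w`. -/
def GeodesicEquationAt (g : LorentzianMetric X) (γ : ℝ → X) (t : ℝ) : Prop :=
  let u : ℝ → Plane := fun s ↦ extChartAt (𝓡 2) (γ t) (γ s)
  let G : Plane → Plane → Plane → ℝ := coordMetric g (γ t)
  ∀ w : Plane,
    G (u t) (deriv (deriv u) t) w
      + fderiv ℝ (fun z ↦ G z (deriv u t) w) (u t) (deriv u t)
      - (1 / 2) * fderiv ℝ (fun z ↦ G z (deriv u t) (deriv u t)) (u t) w = 0

/-- `γ` is a geodesic, affinely parametrized by the nonempty open interval `J`. The values of `γ`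
outside `J` are irrelevant. -/
structure IsGeodesicOn (g : LorentzianMetric X) (γ : ℝ → X) (J : Set ℝ) : Prop where
  isOpen : IsOpen J
  ordConnected : J.OrdConnected
  nonempty : J.Nonempty
  contMDiffOn : ContMDiffOn 𝓘(ℝ, ℝ) (𝓡 2) ∞ γ J
  equation : ∀ t ∈ J, GeodesicEquationAt g γ t

/-- A geodesic which cannot be extended, as a geodesic, to a larger interval. -/
def IsMaximalGeodesic (g : LorentzianMetric X) (γ : ℝ → X) (J : Set ℝ) : Prop :=
  IsGeodesicOn g γ J ∧
    ∀ (γ' : ℝ → X) (J' : Set ℝ), IsGeodesicOn g γ' J' → J ⊆ J' → EqOn γ γ' J → J' = J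

/-- Null completeness: every null geodesic extends to a geodesic parametrized by `ℝ`. -/
def IsNullComplete (g : LorentzianMetric X) : Prop :=
  ∀ (γ : ℝ → X) (J : Set ℝ), IsGeodesicOn g γ J →
    (∀ t ∈ J, velocity γ t ≠ 0 ∧ normSqVelocity g γ t = 0) →
    ∃ γ' : ℝ → X, IsGeodesicOn g γ' univ ∧ EqOn γ γ' J

/-- `K` is a complete Killing field: it generates a smooth flow, defined for all times, which
consists of isometries. -/
def IsCompleteKillingField (g : LorentzianMetric X) (K : ∀ p : X, TangentSpace (𝓡 2) p) : Prop :=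
  ∃ φ : ℝ → X → X,
    ContMDiff (𝓘(ℝ, ℝ).prod (𝓡 2)) (𝓡 2) ∞ (fun q : ℝ × X ↦ φ q.1 q.2) ∧
    (∀ p, φ 0 p = p) ∧
    (∀ s t p, φ (s + t) p = φ s (φ t p)) ∧
    (∀ p, IsMIntegralCurve (I := 𝓡 2) (fun t ↦ φ t p) K) ∧
    (∀ t p (v w : TangentSpace (𝓡 2) p),
      g.val (φ t p) (mfderiv (𝓡 2) (𝓡 2) (φ t) p v) (mfderiv (𝓡 2) (𝓡 2) (φ t) p w)
        = g.val p v w)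

/-- `U` is saturated by `K`: it contains every orbit of `K` that it meets. -/
def IsSaturated (K : ∀ p : X, TangentSpace (𝓡 2) p) (U : Set X) : Prop :=
  ∀ γ : ℝ → X, IsMIntegralCurve (I := 𝓡 2) γ K → γ 0 ∈ U → ∀ t, γ t ∈ U

/-- A ribbon: an open, simply connected set, saturated by `K`, on which `K` does not vanish, and in
which one of the two null foliations is everywhere transverse to `K`. Since `U` is simply connected,
that foliation is spanned by a smooth null vector field `L` on `U`. -/
structure IsRibbon (g : LorentzianMetric X) (K : ∀ p : X, TangentSpace (𝓡 2) p)
    (U : Set X) : Prop where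
  isOpen : IsOpen U
  isSimplyConnected : IsSimplyConnected U
  isSaturated : IsSaturated K U
  ne_zero : ∀ p ∈ U, K p ≠ 0
  transverse : ∃ L : ∀ p : X, TangentSpace (𝓡 2) p,
    ContMDiffOn (𝓡 2) (𝓡 2).tangent ∞ (fun p ↦ (⟨p, L p⟩ : TangentBundle (𝓡 2) X)) U ∧
    ∀ p ∈ U, g.val p (L p) (L p) = 0 ∧ LinearIndependent ℝ ![L p, K p]

/-- A ribbon which is not properly contained in another ribbon. -/
def IsMaximalRibbon (g : LorentzianMetric X) (K : ∀ p : X, TangentSpace (𝓡 2) p)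
    (R : Set X) : Prop :=
  Maximal (IsRibbon g K) R

/-- `x` is the transverse coordinate of `(X, K)`, which is determined up to translation and change
of sign: a smooth function with `dx = ± ν(K, ·)`, where `ν` is the area form of the metric. Here
`ν(K, v)² = ⟨K, v⟩² - ⟨K, K⟩ ⟨v, v⟩`. Where the metric reads `2 dx dy + f(x) dy²` with `K = ∂_y`,
this is the coordinate `x` of these expressions. -/
def IsTransverseCoordinate (g : LorentzianMetric X) (K : ∀ p : X, TangentSpace (𝓡 2) p)
    (x : X → ℝ) : Prop :=
  ContMDiff (𝓡 2) 𝓘(ℝ, ℝ) ∞ x ∧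
    ∀ (p : X) (v : TangentSpace (𝓡 2) p),
      ((show ℝ from mfderiv (𝓡 2) 𝓘(ℝ, ℝ) x p v) : ℝ) ^ 2
        = g.val p (K p) v ^ 2 - g.val p (K p) (K p) * g.val p v v

/-- `γ : J → X` is a maximal geodesic of type `ε` (spacelike for `ε = 1`, timelike for `ε = -1`)
which is contained in `R` after a certain while, and for which the interval `I⁺` of the values of
`x ∘ γ` after that while is unbounded, `x` being oriented so that it increases along `γ`: `I⁺` is
unbounded above. -/
def TraversesRibbon (g : LorentzianMetric X) (x : X → ℝ) (R : Set X) (ε : ℝ)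
    (γ : ℝ → X) (J : Set ℝ) : Prop :=
  IsMaximalGeodesic g γ J ∧
    (∀ t ∈ J, 0 < ε * normSqVelocity g γ t) ∧
    ∃ t₀ ∈ J, (∀ t ∈ J, t₀ ≤ t → γ t ∈ R) ∧ ¬ BddAbove ((fun t ↦ x (γ t)) '' (J ∩ Ici t₀))

end Surface

/-- The analytic condition on the norm function `f` of a ribbon, for geodesics of type `ε`. -/
def ConditionCR (ε : ℝ) (f : ℝ → ℝ) : Prop :=
  (∃ M > 0, volume ({s : ℝ | -ε * f s ≤ M} ∩ Ici 0) = ⊤) ∨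
    ((∀ M > 0, volume ({s : ℝ | -ε * f s ≤ M} ∩ Ici 0) < ⊤) ∧
      ∃ α > 0, ∫⁻ s in {s : ℝ | α ≤ -ε * f s} ∩ Ici 0,
        ENNReal.ofReal (1 / Real.sqrt (-ε * f s)) = ⊤)

/-!
The proof reduces the completeness of the geodesics to a one-dimensional motion in a potential.

*The ribbon is a plane.* Let `φ` be the flow of the Killing field `K`. Through a point of a ribbon
there is a null curve which is transverse to `K`, and it can be parametrized by the transverse
coordinate `x`; then `⟨c', K⟩ = σ = ±1` (`IsRibbon.exists_isNullTransversalOn`). Such a curve is a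
geodesic, so by null completeness it extends to a curve `c` with the same properties which is
defined on `ℝ` (`IsNullTransversalOn.exists_extension`). In the coordinates `(s, t) ↦ φ t (c s)` the
metric reads `2 σ ds dt + k(s) dt²` with `k = ⟨K, K⟩ ∘ c`
(`IsNullTransversalOn.pullMetric_flowMap`), and this map is injective, because `X` is simply
connected: otherwise the orbits of `K` which meet `c` would be periodic, and `X` would be a cylinder
(`IsNullTransversalOn.injective_flowMap`). So its range is a ribbon, which contains the given one.
Hence a maximal ribbon is such a range (`IsMaximalRibbon.exists_eq_range`). In particular `f = k` is
smooth, and `x` takes every real value on the ribbon.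

*Complete geodesics.* The geodesic equation is used through the first variation formula
`geodesicDefect_eq` only, applied to variations `H : ℝ × ℝ → X` of a curve. It shows that
`⟨γ', γ'⟩` and the momentum `⟨γ', K⟩` are constant along a geodesic `γ`. Since
`(x ∘ γ)'² = ⟨γ', K⟩² - ⟨K, K⟩ ⟨γ', γ'⟩`, the coordinate `u = x ∘ γ` satisfies
`u'² = D + E (-ε f(u))` with constants `D ≥ 0` and `E > 0` as long as `γ` is in the ribbon. If `u`
is unbounded above and the time is bounded, then `∫ dy / √(D + E (-ε f(y)) + 1)` converges at `+∞`
(`integrableOn_of_bddAbove`), and this contradicts the analytic condition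
(`TraversesRibbon.not_conditionCR`). If `f` is bounded, the analytic condition holds trivially.

*An incomplete geodesic.* If `-ε f` is bounded below and the analytic condition fails, choose `C` so
large that `v² = C² - ε f ≥ 1`. Then `∫ ds / v(s)` converges at `+∞`
(`integrableOn_of_not_conditionCR`), and the solution of `p' = v(p)` reaches `+∞` in finite time
(`exists_motion`). It is the coordinate `x` of an explicit geodesic with momentum `σ C`
(`IsNullTransversalOn.exists_geodesic`), which is maximal because `x` takes all real values on it.
-/

open Filter Topology

/-! ### Calculus of a field of bilinear forms along maps -/

section Calculus

variable {F : Type*} [NormedAddCommGroup F] [NormedSpace ℝ F]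

/-- The Euler–Lagrange expression of the energy `B z (u', u') / 2`, contracted with the variation
field `w = ∂₂ h`, expressed by the derivatives of the pulled back form along a two-parameter
family `h` whose base curve is `u = h (·, 0)`. -/
theorem firstVariation_of_contDiffAt {B : F → F →L[ℝ] F →L[ℝ] ℝ} {h : ℝ × ℝ → F} {t : ℝ}
    (hB : DifferentiableAt ℝ B (h (t, 0))) (hh : ContDiffAt ℝ ∞ h (t, 0))
    (hsymm : ∀ v w, B (h (t, 0)) v w = B (h (t, 0)) w v) :
    B (h (t, 0)) (deriv (deriv fun s ↦ h (s, 0)) t) (fderiv ℝ h (t, 0) (0, 1))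
      + fderiv ℝ (fun z ↦ B z (deriv (fun s ↦ h (s, 0)) t) (fderiv ℝ h (t, 0) (0, 1))) (h (t, 0))
          (deriv (fun s ↦ h (s, 0)) t)
      - (1 / 2) * fderiv ℝ
          (fun z ↦ B z (deriv (fun s ↦ h (s, 0)) t) (deriv (fun s ↦ h (s, 0)) t)) (h (t, 0))
          (fderiv ℝ h (t, 0) (0, 1))
    = fderiv ℝ (fun q ↦ B (h q) (fderiv ℝ h q (1, 0)) (fderiv ℝ h q (0, 1))) (t, 0) (1, 0)
      - (1 / 2) * fderiv ℝ (fun q ↦ B (h q) (fderiv ℝ h q (1, 0)) (fderiv ℝ h q (1, 0))) (t, 0)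
          (0, 1) := by
  have hline : ∀ s : ℝ, HasDerivAt (fun s : ℝ ↦ ((s, 0) : ℝ × ℝ)) (1, 0) s := fun s ↦
    (hasDerivAt_id s).prodMk (hasDerivAt_const s (0 : ℝ))
  have hev : ∀ᶠ s in 𝓝 t, DifferentiableAt ℝ h (s, 0) := by
    have h1 : ∀ᶠ q in 𝓝 (t, (0 : ℝ)), DifferentiableAt ℝ h q := by
      have := (hh.of_le (m := 1) (by norm_cast)).eventually (by simp)
      filter_upwards [this] with q hq using hq.differentiableAt (by simp)
    exact (hline t).continuousAt.eventually h1
  have hd1 : deriv (fun s ↦ h (s, 0)) =ᶠ[𝓝 t] fun s ↦ fderiv ℝ h (s, 0) (1, 0) := by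
    filter_upwards [hev] with s hs
    exact (hs.hasFDerivAt.comp_hasDerivAt s (hline s)).deriv
  have hD : DifferentiableAt ℝ (fderiv ℝ h) (t, 0) :=
    (hh.fderiv_right (m := 1) (by norm_cast)).differentiableAt (by simp)
  have hh1 : DifferentiableAt ℝ h (t, 0) := hev.self_of_nhds
  have hd2 : deriv (deriv fun s ↦ h (s, 0)) t = fderiv ℝ (fderiv ℝ h) (t, 0) (1, 0) (1, 0) := by
    rw [hd1.deriv_eq]
    have h1 : HasDerivAt (fun s : ℝ ↦ fderiv ℝ h (s, 0)) (fderiv ℝ (fderiv ℝ h) (t, 0) (1, 0)) t :=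
      HasFDerivAt.comp_hasDerivAt (l := fderiv ℝ h) (f := fun s : ℝ ↦ ((s, 0) : ℝ × ℝ)) t
        hD.hasFDerivAt (hline t)
    have h2 : HasDerivAt (fun s : ℝ ↦ fderiv ℝ h (s, 0) (1, 0))
        (fderiv ℝ (fderiv ℝ h) (t, 0) (1, 0) (1, 0)) t := by
      simpa using h1.clm_apply (hasDerivAt_const t ((1, 0) : ℝ × ℝ))
    exact h2.deriv
  -- mixed second derivatives of `h` commute
  have hsym := (hh.isSymmSndFDerivAt (by simp; norm_cast)).eq (1, 0) (0, 1)
  have hform : ∀ a b c : ℝ × ℝ,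
      fderiv ℝ (fun q ↦ B (h q) (fderiv ℝ h q a) (fderiv ℝ h q b)) (t, 0) c
        = fderiv ℝ B (h (t, 0)) (fderiv ℝ h (t, 0) c) (fderiv ℝ h (t, 0) a) (fderiv ℝ h (t, 0) b)
          + B (h (t, 0)) (fderiv ℝ (fderiv ℝ h) (t, 0) c a) (fderiv ℝ h (t, 0) b)
          + B (h (t, 0)) (fderiv ℝ h (t, 0) a) (fderiv ℝ (fderiv ℝ h) (t, 0) c b) := by
    intro a b c
    have hBh : HasFDerivAt (fun q ↦ B (h q)) ((fderiv ℝ B (h (t, 0))).comp (fderiv ℝ h (t, 0)))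
        (t, 0) := HasFDerivAt.comp (g := B) (f := h) (t, (0 : ℝ)) hB.hasFDerivAt hh1.hasFDerivAt
    have hDc : ∀ a : ℝ × ℝ, HasFDerivAt (fun q ↦ fderiv ℝ h q a)
        ((fderiv ℝ (fderiv ℝ h) (t, 0)).flip a) (t, 0) := fun a ↦ by
      simpa using hD.hasFDerivAt.clm_apply (hasFDerivAt_const a (t, (0 : ℝ)))
    rw [((hBh.clm_apply (hDc a)).clm_apply (hDc b)).fderiv]
    simp
    ring
  have hB' : ∀ a b c : F,
      fderiv ℝ (fun z ↦ B z a b) (h (t, 0)) c = fderiv ℝ B (h (t, 0)) c a b := by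
    intro a b c
    have h1 := (hB.hasFDerivAt.clm_apply (hasFDerivAt_const a _)).clm_apply (hasFDerivAt_const b _)
    rw [h1.fderiv]
    simp
  rw [hB', hB', hform, hform, hd2, hd1.self_of_nhds, ← hsym,
    hsymm (fderiv ℝ h (t, 0) (1, 0)) (fderiv ℝ (fderiv ℝ h) (t, 0) (1, 0) (0, 1))]
  ring

end Calculus

section Surface

variable {X : Type*} [TopologicalSpace X] [ChartedSpace Plane X] [IsManifold (𝓡 2) ∞ X]

/-- The metric pulled back by a map `H` from a normed space. -/
noncomputable def pullMetric (g : LorentzianMetric X) {E : Type*} [NormedAddCommGroup E]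
    [NormedSpace ℝ E] (H : E → X) (q v w : E) : ℝ :=
  g.val (H q) (mfderiv 𝓘(ℝ, E) (𝓡 2) H q v) (mfderiv 𝓘(ℝ, E) (𝓡 2) H q w)

section

variable {E : Type*} [NormedAddCommGroup E] [NormedSpace ℝ E]

theorem contMDiffOn_mfderiv_const {H : E → X} {O : Set E} (hO : IsOpen O)
    (hH : ContMDiffOn 𝓘(ℝ, E) (𝓡 2) ∞ H O) (v : E) :
    ContMDiffOn 𝓘(ℝ, E) (𝓡 2).tangent ∞
      (fun q ↦ (⟨H q, mfderiv 𝓘(ℝ, E) (𝓡 2) H q v⟩ : TangentBundle (𝓡 2) X)) O := by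
  have h1 := hH.contMDiffOn_tangentMapWithin (m := ∞) (by simp) hO.uniqueMDiffOn
  have h2 : ContMDiffOn 𝓘(ℝ, E) 𝓘(ℝ, E).tangent ∞
      (fun q ↦ (⟨q, v⟩ : TangentBundle 𝓘(ℝ, E) E)) O :=
    contMDiffOn_vectorSpace_iff_contDiffOn.2 contDiffOn_const
  refine (h1.comp h2 fun q hq ↦ hq).congr fun q hq ↦ ?_
  simp [tangentMapWithin, mfderivWithin_of_isOpen hO hq]

theorem contDiffOn_pullMetric (g : LorentzianMetric X) {H : E → X} {O : Set E} (hO : IsOpen O)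
    (hH : ContMDiffOn 𝓘(ℝ, E) (𝓡 2) ∞ H O) (v w : E) :
    ContDiffOn ℝ ∞ (fun q ↦ pullMetric g H q v w) O := by
  have h1 := contMDiffOn_mfderiv_const hO hH v
  have h2 := contMDiffOn_mfderiv_const hO hH w
  have h3 := g.contMDiff.comp_contMDiffOn hH
  have h4 := ContMDiffOn.clm_bundle_apply₂ (F₃ := ℝ) (E₃ := Bundle.Trivial X ℝ) h3 h1 h2
  intro q hq
  have := h4 q hq
  rw [Bundle.contMDiffWithinAt_totalSpace] at this
  exact this.2.contDiffWithinAt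

theorem pullMetric_eq_coordMetric (g : LorentzianMetric X) {H : E → X} {q : E} {p : X}
    (hq : H q ∈ (extChartAt (𝓡 2) p).source) (hH : MDifferentiableAt 𝓘(ℝ, E) (𝓡 2) H q) (v w : E) :
    pullMetric g H q v w = coordMetric g p (extChartAt (𝓡 2) p (H q))
      (fderiv ℝ (fun q ↦ extChartAt (𝓡 2) p (H q)) q v)
      (fderiv ℝ (fun q ↦ extChartAt (𝓡 2) p (H q)) q w) := by
  set e := extChartAt (𝓡 2) p with he
  have hs : ∀ᶠ q' in 𝓝 q, H q' ∈ e.source :=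
    hH.continuousAt.eventually ((isOpen_extChartAt_source p).mem_nhds hq)
  have hsymm : MDifferentiableAt 𝓘(ℝ, Plane) (𝓡 2) e.symm (e (H q)) :=
    ((contMDiffOn_extChartAt_symm (n := ∞) p).contMDiffAt
      ((isOpen_extChartAt_target p).mem_nhds (e.map_source hq))).mdifferentiableAt (by simp)
  have hee : MDifferentiableAt (𝓡 2) 𝓘(ℝ, Plane) e (H q) :=
    mdifferentiableAt_extChartAt (by simpa [he] using hq)
  have heH : MDifferentiableAt 𝓘(ℝ, E) 𝓘(ℝ, Plane) (fun q ↦ e (H q)) q := hee.comp q hH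
  have key : mfderiv 𝓘(ℝ, E) (𝓡 2) H q
      = (mfderiv 𝓘(ℝ, Plane) (𝓡 2) e.symm (e (H q))).comp (fderiv ℝ (fun q ↦ e (H q)) q) := by
    have h1 : H =ᶠ[𝓝 q] e.symm ∘ (fun q ↦ e (H q)) := by
      filter_upwards [hs] with q' hq' using (e.left_inv hq').symm
    rw [h1.mfderiv_eq, mfderiv_comp q hsymm heH, mfderiv_eq_fderiv]
    rfl
  have hval : ∀ (p₁ p₂ : X) (_ : p₁ = p₂) (a b : Plane), g.val p₁ a b = g.val p₂ a b := by
    rintro p₁ _ rfl a b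
    rfl
  unfold pullMetric coordMetric
  rw [key]
  exact hval _ _ (e.left_inv hq).symm _ _

end

/-- The metric in the coordinates of the chart at `p`, as a field of bilinear forms. -/
noncomputable def coordMetricL (g : LorentzianMetric X) (p : X) (z : Plane) :
    Plane →L[ℝ] Plane →L[ℝ] ℝ :=
  ContinuousLinearMap.bilinearComp (E := Plane) (F := Plane) (G := ℝ)
    (g.val ((extChartAt (𝓡 2) p).symm z))
    (mfderiv 𝓘(ℝ, Plane) (𝓡 2) (extChartAt (𝓡 2) p).symm z)
    (mfderiv 𝓘(ℝ, Plane) (𝓡 2) (extChartAt (𝓡 2) p).symm z)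

theorem coordMetricL_apply (g : LorentzianMetric X) (p : X) (z a b : Plane) :
    coordMetricL g p z a b = coordMetric g p z a b := rfl

theorem contDiffOn_coordMetricL (g : LorentzianMetric X) (p : X) :
    ContDiffOn ℝ ∞ (coordMetricL g p) (extChartAt (𝓡 2) p).target :=
  contDiffOn_clm_apply.2 fun v ↦ contDiffOn_clm_apply.2 fun w ↦
    contDiffOn_pullMetric g (isOpen_extChartAt_target p)
      (contMDiffOn_extChartAt_symm (n := ∞) p) v w

/-- The left-hand side of the geodesic equation of `γ` at time `t`, contracted with `w`. -/
noncomputable def geodesicDefect (g : LorentzianMetric X) (γ : ℝ → X) (t : ℝ) (w : Plane) : ℝ :=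
  let u : ℝ → Plane := fun s ↦ extChartAt (𝓡 2) (γ t) (γ s)
  let G : Plane → Plane → Plane → ℝ := coordMetric g (γ t)
  G (u t) (deriv (deriv u) t) w
      + fderiv ℝ (fun z ↦ G z (deriv u t) w) (u t) (deriv u t)
      - (1 / 2) * fderiv ℝ (fun z ↦ G z (deriv u t) (deriv u t)) (u t) w

theorem geodesicEquationAt_iff {g : LorentzianMetric X} {γ : ℝ → X} {t : ℝ} :
    GeodesicEquationAt g γ t ↔ ∀ w, geodesicDefect g γ t w = 0 := Iff.rfl

/-- The first variation formula: for a two-parameter family `H` with base curve `γ = H (·, 0)`, the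
defect of `γ` from being a geodesic, in the direction of the variation field `∂₂ H`, is
`∂₁ ⟨∂₁ H, ∂₂ H⟩ - ∂₂ ⟨∂₁ H, ∂₁ H⟩ / 2`, an expression which does not refer to charts. -/
theorem geodesicDefect_eq (g : LorentzianMetric X) {H : ℝ × ℝ → X} {O : Set (ℝ × ℝ)}
    (hO : IsOpen O) (hH : ContMDiffOn 𝓘(ℝ, ℝ × ℝ) (𝓡 2) ∞ H O) {t : ℝ} (ht : (t, 0) ∈ O) :
    geodesicDefect g (fun s ↦ H (s, 0)) t
        (fderiv ℝ (fun q ↦ extChartAt (𝓡 2) (H (t, 0)) (H q)) (t, 0) (0, 1))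
      = fderiv ℝ (fun q ↦ pullMetric g H q (1, 0) (0, 1)) (t, 0) (1, 0)
        - (1 / 2) * fderiv ℝ (fun q ↦ pullMetric g H q (1, 0) (1, 0)) (t, 0) (0, 1) := by
  set e := extChartAt (𝓡 2) (H (t, 0)) with he
  have hHt : ContMDiffAt 𝓘(ℝ, ℝ × ℝ) (𝓡 2) ∞ H (t, 0) := hH.contMDiffAt (hO.mem_nhds ht)
  have hsrc : ∀ᶠ q in 𝓝 (t, (0 : ℝ)), H q ∈ e.source :=
    hHt.continuousAt.eventually (extChartAt_source_mem_nhds (H (t, 0)))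
  have hh : ContDiffAt ℝ ∞ (fun q ↦ e (H q)) (t, 0) :=
    (ContMDiffAt.comp (t, (0 : ℝ)) (contMDiffAt_extChartAt (n := ∞)) hHt).contDiffAt
  have hpull : ∀ a b : ℝ × ℝ, (fun q ↦ pullMetric g H q a b) =ᶠ[𝓝 (t, (0 : ℝ))]
      fun q ↦ coordMetricL g (H (t, 0)) (e (H q)) (fderiv ℝ (fun q ↦ e (H q)) q a)
        (fderiv ℝ (fun q ↦ e (H q)) q b) := by
    intro a b
    filter_upwards [hsrc, hO.mem_nhds ht] with q hq hqO
    rw [pullMetric_eq_coordMetric g hq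
      ((hH.contMDiffAt (hO.mem_nhds hqO)).mdifferentiableAt (by simp)), coordMetricL_apply]
  have hB : DifferentiableAt ℝ (coordMetricL g (H (t, 0))) (e (H (t, 0))) :=
    ((contDiffOn_coordMetricL g _).contDiffAt
      (extChartAt_target_mem_nhds (H (t, 0)))).differentiableAt (by simp)
  have := firstVariation_of_contDiffAt (h := fun q ↦ e (H q)) hB hh fun v w ↦ g.symm _ _ _
  rw [(hpull _ _).fderiv_eq, (hpull _ _).fderiv_eq, ← this]
  rfl

end Surface

/-! ### Killing flows, and quantities conserved along geodesics -/

theorem mfderiv_comp_real {X : Type*} [TopologicalSpace X] [ChartedSpace Plane X] {E : Type*}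
    [NormedAddCommGroup E] [NormedSpace ℝ E] {c : ℝ → X} {l : E → ℝ} {l' : E →L[ℝ] ℝ} {q : E}
    (hc : MDifferentiableAt 𝓘(ℝ, ℝ) (𝓡 2) c (l q))
    (hl : HasFDerivAt l l' q) (v : E) :
    (mfderiv 𝓘(ℝ, E) (𝓡 2) (fun q ↦ c (l q)) q v : Plane) = l' v • (velocity c (l q) : Plane) := by
  have h1 := HasMFDerivAt.comp q hc.hasMFDerivAt hl.hasMFDerivAt
  have h2 := h1.mfderiv
  simp only [Function.comp_def] at h2
  rw [h2]
  let A : ℝ →L[ℝ] Plane := mfderiv 𝓘(ℝ, ℝ) (𝓡 2) c (l q)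
  change A (l' v) = l' v • A 1
  rw [← map_smul, smul_eq_mul, mul_one]

section Surface

variable {X : Type*} [TopologicalSpace X] [ChartedSpace Plane X] [IsManifold (𝓡 2) ∞ X]

/-- `φ` is the flow of the Killing field `K`. -/
structure IsKillingFlow (g : LorentzianMetric X) (K : ∀ p : X, TangentSpace (𝓡 2) p)
    (φ : ℝ → X → X) : Prop where
  contMDiff : ContMDiff (𝓘(ℝ, ℝ).prod (𝓡 2)) (𝓡 2) ∞ (fun q : ℝ × X ↦ φ q.1 q.2)
  map_zero (p : X) : φ 0 p = p
  map_add (s t : ℝ) (p : X) : φ (s + t) p = φ s (φ t p)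
  isMIntegralCurve (p : X) : IsMIntegralCurve (I := 𝓡 2) (fun t ↦ φ t p) K
  isometry (t : ℝ) (p : X) (v w : TangentSpace (𝓡 2) p) :
    g.val (φ t p) (mfderiv (𝓡 2) (𝓡 2) (φ t) p v) (mfderiv (𝓡 2) (𝓡 2) (φ t) p w) = g.val p v w

theorem IsCompleteKillingField.exists_flow {g : LorentzianMetric X}
    {K : ∀ p : X, TangentSpace (𝓡 2) p} (hK : IsCompleteKillingField g K) :
    ∃ φ, IsKillingFlow g K φ := by
  obtain ⟨φ, h1, h2, h3, h4, h5⟩ := hK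
  exact ⟨φ, h1, h2, h3, h4, h5⟩

/-- The number `⟨c', K⟩` at time `t`. -/
noncomputable def momentum (g : LorentzianMetric X) (K : ∀ p : X, TangentSpace (𝓡 2) p)
    (c : ℝ → X) (t : ℝ) : ℝ :=
  g.val (c t) (velocity c t) (K (c t))

/-- The map which moves a curve `c` by a flow `φ`. -/
def flowMap (φ : ℝ → X → X) (c : ℝ → X) (q : ℝ × ℝ) : X := φ q.2 (c q.1)

theorem bilin_apply_add_smul (B : Plane →L[ℝ] Plane →L[ℝ] ℝ) {a b : Plane} (hB : B b a = B a b)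
    (v w : ℝ × ℝ) : B (v.1 • a + v.2 • b) (w.1 • a + w.2 • b)
      = v.1 * w.1 * B a a + (v.1 * w.2 + v.2 * w.1) * B a b + v.2 * w.2 * B b b := by
  simp only [map_add, map_smul, add_apply, smul_apply, smul_eq_mul, hB]
  ring

namespace IsKillingFlow

variable {g : LorentzianMetric X} {K : ∀ p : X, TangentSpace (𝓡 2) p} {φ : ℝ → X → X}

theorem contMDiff_flow (h : IsKillingFlow g K φ) (t : ℝ) : ContMDiff (𝓡 2) (𝓡 2) ∞ (φ t) :=
  h.contMDiff.comp (contMDiff_const.prodMk contMDiff_id)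

theorem velocity_flow (h : IsKillingFlow g K φ) (p : X) (t : ℝ) :
    velocity (fun t ↦ φ t p) t = K (φ t p) := by
  have := (h.isMIntegralCurve p t).mfderiv
  unfold velocity
  rw [this]
  exact one_smul ℝ (K (φ t p) : Plane)

theorem mfderiv_flow_field (h : IsKillingFlow g K φ) (t : ℝ) (p : X) :
    mfderiv (𝓡 2) (𝓡 2) (φ t) p (K p) = K (φ t p) := by
  have h0 := h.map_zero p
  have h1 : HasMFDerivAt 𝓘(ℝ, ℝ) (𝓡 2) (fun s ↦ φ s p) 0
      ((1 : ℝ →L[ℝ] ℝ).smulRight (K (φ 0 p))) := h.isMIntegralCurve p 0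
  have h2 : HasMFDerivAt (𝓡 2) (𝓡 2) (φ t) (φ 0 p) (mfderiv (𝓡 2) (𝓡 2) (φ t) (φ 0 p)) :=
    ((h.contMDiff_flow t).mdifferentiable (by simp) _).hasMFDerivAt
  have h3 := (HasMFDerivAt.comp (0 : ℝ) h2 h1).mfderiv
  have h4 : φ t ∘ (fun s ↦ φ s p) = fun s ↦ φ s (φ t p) := by
    funext s
    simp only [Function.comp]
    rw [← h.map_add, add_comm, h.map_add]
  have h5 : (velocity (fun s ↦ φ s (φ t p)) 0 : Plane) = K (φ 0 (φ t p)) :=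
    h.velocity_flow (φ t p) 0
  have h6 : (K (φ 0 (φ t p)) : Plane) = K (φ t (φ 0 p)) :=
    congrArg (fun p ↦ (K p : Plane)) (by rw [h.map_zero, h.map_zero])
  have h7 : (velocity (fun s ↦ φ s (φ t p)) 0 : Plane)
      = mfderiv (𝓡 2) (𝓡 2) (φ t) (φ 0 p) (K (φ 0 p)) := by
    unfold velocity
    rw [← h4, h3]
    exact congrArg (mfderiv (𝓡 2) (𝓡 2) (φ t) (φ 0 p)) (one_smul ℝ (K (φ 0 p) : Plane))
  have h8 : (mfderiv (𝓡 2) (𝓡 2) (φ t) (φ 0 p) (K (φ 0 p)) : Plane) = K (φ t (φ 0 p)) :=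
    h7.symm.trans (h5.trans h6)
  rw [h0] at h8
  exact h8

theorem contMDiffOn_flowMap (h : IsKillingFlow g K φ) {c : ℝ → X} {I : Set ℝ}
    (hc : ContMDiffOn 𝓘(ℝ, ℝ) (𝓡 2) ∞ c I) :
    ContMDiffOn 𝓘(ℝ, ℝ × ℝ) (𝓡 2) ∞ (flowMap φ c) (I ×ˢ univ) := by
  have h1 : ContMDiffOn 𝓘(ℝ, ℝ × ℝ) 𝓘(ℝ, ℝ) ∞ (fun q : ℝ × ℝ ↦ q.1) (I ×ˢ univ) :=
    contDiff_fst.contMDiff.contMDiffOn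
  have h2 : ContMDiffOn 𝓘(ℝ, ℝ × ℝ) 𝓘(ℝ, ℝ) ∞ (fun q : ℝ × ℝ ↦ q.2) (I ×ˢ univ) :=
    contDiff_snd.contMDiff.contMDiffOn
  exact h.contMDiff.comp_contMDiffOn (h2.prodMk (hc.comp h1 fun q hq ↦ hq.1))

theorem mfderiv_flowMap (h : IsKillingFlow g K φ) {c : ℝ → X} {I : Set ℝ} (hI : IsOpen I)
    (hc : ContMDiffOn 𝓘(ℝ, ℝ) (𝓡 2) ∞ c I) {q : ℝ × ℝ} (hq : q.1 ∈ I) (v : ℝ × ℝ) :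
    (mfderiv 𝓘(ℝ, ℝ × ℝ) (𝓡 2) (flowMap φ c) q v : Plane)
      = v.1 • (mfderiv (𝓡 2) (𝓡 2) (φ q.2) (c q.1) (velocity c q.1) : Plane)
        + v.2 • (K (φ q.2 (c q.1)) : Plane) := by
  have hd : MDifferentiableAt 𝓘(ℝ, ℝ × ℝ) (𝓡 2) (flowMap φ c) q :=
    ((h.contMDiffOn_flowMap hc).contMDiffAt
      ((hI.prod isOpen_univ).mem_nhds ⟨hq, mem_univ _⟩)).mdifferentiableAt (by simp)
  have hcd : MDifferentiableAt 𝓘(ℝ, ℝ) (𝓡 2) c q.1 :=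
    (hc.contMDiffAt (hI.mem_nhds hq)).mdifferentiableAt (by simp)
  let A : ℝ × ℝ →L[ℝ] Plane := mfderiv 𝓘(ℝ, ℝ × ℝ) (𝓡 2) (flowMap φ c) q
  have h1 : A (1, 0) = (mfderiv (𝓡 2) (𝓡 2) (φ q.2) (c q.1) (velocity c q.1) : Plane) := by
    have l : HasFDerivAt (fun s : ℝ ↦ (s, q.2)) (ContinuousLinearMap.inl ℝ ℝ ℝ) q.1 :=
      hasFDerivAt_prodMk_left q.1 q.2
    have e1 := (HasMFDerivAt.comp q.1 (g := flowMap φ c) hd.hasMFDerivAt l.hasMFDerivAt).mfderiv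
    have e2 := (HasMFDerivAt.comp q.1 (g := φ q.2)
      ((h.contMDiff_flow q.2).mdifferentiable (by simp) _).hasMFDerivAt hcd.hasMFDerivAt).mfderiv
    exact congrArg (fun B : ℝ →L[ℝ] Plane ↦ B 1) (e1.symm.trans e2)
  have h2 : A (0, 1) = (K (φ q.2 (c q.1)) : Plane) := by
    have l : HasFDerivAt (fun s : ℝ ↦ (q.1, s)) (ContinuousLinearMap.inr ℝ ℝ ℝ) q.2 :=
      hasFDerivAt_prodMk_right q.1 q.2
    have e1 := (HasMFDerivAt.comp q.2 (g := flowMap φ c) hd.hasMFDerivAt l.hasMFDerivAt).mfderiv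
    exact (congrArg (fun B : ℝ →L[ℝ] Plane ↦ B 1) e1.symm).trans (h.velocity_flow (c q.1) q.2)
  have h3 : v = v.1 • ((1, 0) : ℝ × ℝ) + v.2 • ((0, 1) : ℝ × ℝ) := by ext <;> simp
  have h4 : A v = v.1 • A (1, 0) + v.2 • A (0, 1) := by
    conv_lhs => rw [h3]
    rw [_root_.map_add, map_smul, map_smul]
  exact h4.trans (congrArg₂ (fun a b : Plane ↦ v.1 • a + v.2 • b) h1 h2)

/-- The metric pulled back by `flowMap φ c` does not depend on the flow parameter. -/
theorem pullMetric_flowMap (h : IsKillingFlow g K φ) {c : ℝ → X} {I : Set ℝ} (hI : IsOpen I)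
    (hc : ContMDiffOn 𝓘(ℝ, ℝ) (𝓡 2) ∞ c I) {q : ℝ × ℝ} (hq : q.1 ∈ I) (v w : ℝ × ℝ) :
    pullMetric g (flowMap φ c) q v w = v.1 * w.1 * normSqVelocity g c q.1
      + (v.1 * w.2 + v.2 * w.1) * momentum g K c q.1
      + v.2 * w.2 * g.val (c q.1) (K (c q.1)) (K (c q.1)) := by
  have h1 := h.isometry q.2 (c q.1) (velocity c q.1) (velocity c q.1)
  have h2 := h.isometry q.2 (c q.1) (velocity c q.1) (K (c q.1))
  have h3 := h.isometry q.2 (c q.1) (K (c q.1)) (K (c q.1))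
  rw [h.mfderiv_flow_field] at h2 h3
  have h4 := g.symm (φ q.2 (c q.1)) (K (φ q.2 (c q.1)))
    (mfderiv (𝓡 2) (𝓡 2) (φ q.2) (c q.1) (velocity c q.1))
  unfold normSqVelocity momentum
  rw [← h1, ← h2, ← h3]
  exact (congrArg₂ (fun a b : Plane ↦ (g.val (φ q.2 (c q.1)) : Plane →L[ℝ] Plane →L[ℝ] ℝ) a b)
    (h.mfderiv_flowMap hI hc hq v) (h.mfderiv_flowMap hI hc hq w)).trans
    (bilin_apply_add_smul _ h4 v w)

theorem contDiffOn_momentum (h : IsKillingFlow g K φ) {c : ℝ → X} {I : Set ℝ} (hI : IsOpen I)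
    (hc : ContMDiffOn 𝓘(ℝ, ℝ) (𝓡 2) ∞ c I) : ContDiffOn ℝ ∞ (momentum g K c) I := by
  have h1 := (contDiffOn_pullMetric g (hI.prod isOpen_univ) (h.contMDiffOn_flowMap hc)
    (1, 0) (0, 1)).comp (contDiff_prodMk_left (0 : ℝ)).contDiffOn
    (fun s (hs : s ∈ I) ↦ ⟨hs, mem_univ _⟩)
  refine h1.congr fun s hs ↦ ?_
  simp [h.pullMetric_flowMap hI hc (q := (s, 0)) hs]

theorem contDiffOn_field (h : IsKillingFlow g K φ) {c : ℝ → X} {I : Set ℝ} (hI : IsOpen I)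
    (hc : ContMDiffOn 𝓘(ℝ, ℝ) (𝓡 2) ∞ c I) :
    ContDiffOn ℝ ∞ (fun s ↦ g.val (c s) (K (c s)) (K (c s))) I := by
  have h1 := (contDiffOn_pullMetric g (hI.prod isOpen_univ) (h.contMDiffOn_flowMap hc)
    (0, 1) (0, 1)).comp (contDiff_prodMk_left (0 : ℝ)).contDiffOn
    (fun s (hs : s ∈ I) ↦ ⟨hs, mem_univ _⟩)
  refine h1.congr fun s hs ↦ ?_
  simp [h.pullMetric_flowMap hI hc (q := (s, 0)) hs]

end IsKillingFlow

theorem contDiffOn_normSqVelocity (g : LorentzianMetric X) {c : ℝ → X} {I : Set ℝ} (hI : IsOpen I)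
    (hc : ContMDiffOn 𝓘(ℝ, ℝ) (𝓡 2) ∞ c I) : ContDiffOn ℝ ∞ (normSqVelocity g c) I :=
  contDiffOn_pullMetric g hI hc 1 1

theorem IsGeodesicOn.deriv_normSqVelocity {g : LorentzianMetric X} {γ : ℝ → X} {J : Set ℝ}
    (hγ : IsGeodesicOn g γ J) {t : ℝ} (ht : t ∈ J) : deriv (normSqVelocity g γ) t = 0 := by
  -- the variation of `γ` by its own time translations
  let H : ℝ × ℝ → X := fun q ↦ γ (q.1 + q.2)
  have hO : IsOpen {q : ℝ × ℝ | q.1 + q.2 ∈ J} := hγ.isOpen.preimage (by fun_prop)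
  have hH : ContMDiffOn 𝓘(ℝ, ℝ × ℝ) (𝓡 2) ∞ H {q : ℝ × ℝ | q.1 + q.2 ∈ J} :=
    hγ.contMDiffOn.comp (ContDiff.contMDiff (by fun_prop)).contMDiffOn fun q hq ↦ hq
  have ht' : (t, (0 : ℝ)) ∈ {q : ℝ × ℝ | q.1 + q.2 ∈ J} := by simpa using ht
  have h1 := geodesicDefect_eq g hO hH ht'
  have h2 : (fun s ↦ H (s, 0)) = γ := by funext s; simp [H]
  rw [h2, geodesicEquationAt_iff.1 (hγ.equation t ht)] at h1
  have hN : HasDerivAt (normSqVelocity g γ) (deriv (normSqVelocity g γ) t) (t + 0) := by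
    rw [add_zero]
    exact (((contDiffOn_normSqVelocity g hγ.isOpen hγ.contMDiffOn).contDiffAt
      (hγ.isOpen.mem_nhds ht)).differentiableAt (by simp)).hasDerivAt
  have hl : ∀ q : ℝ × ℝ, HasFDerivAt (fun q : ℝ × ℝ ↦ q.1 + q.2)
    (ContinuousLinearMap.fst ℝ ℝ ℝ + ContinuousLinearMap.snd ℝ ℝ ℝ) q := fun q ↦
      hasFDerivAt_fst.add hasFDerivAt_snd
  have hp : ∀ a b : ℝ × ℝ, a.1 + a.2 = 1 → b.1 + b.2 = 1 → (fun q ↦ pullMetric g H q a b)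
      =ᶠ[𝓝 (t, (0 : ℝ))] fun q ↦ normSqVelocity g γ (q.1 + q.2) := by
    intro a b ha hb
    filter_upwards [hO.mem_nhds ht'] with q hq
    have hd : MDifferentiableAt 𝓘(ℝ, ℝ) (𝓡 2) γ (q.1 + q.2) :=
      (hγ.contMDiffOn.contMDiffAt (hγ.isOpen.mem_nhds hq)).mdifferentiableAt (by simp)
    have e : ∀ a : ℝ × ℝ, a.1 + a.2 = 1 → (mfderiv 𝓘(ℝ, ℝ × ℝ) (𝓡 2) H q a : Plane)
        = velocity γ (q.1 + q.2) := by
      intro a ha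
      have := mfderiv_comp_real (c := γ) (l := fun q : ℝ × ℝ ↦ q.1 + q.2) hd (hl q) a
      simp only [add_apply, ContinuousLinearMap.coe_fst',
        ContinuousLinearMap.coe_snd', ha, one_smul] at this
      exact this
    let B : Plane →L[ℝ] Plane →L[ℝ] ℝ := g.val (γ (q.1 + q.2))
    change B (mfderiv 𝓘(ℝ, ℝ × ℝ) (𝓡 2) H q a : Plane) (mfderiv 𝓘(ℝ, ℝ × ℝ) (𝓡 2) H q b : Plane)
      = _
    rw [e a ha, e b hb]
    rfl
  have hcomp := (HasDerivAt.comp_hasFDerivAt (t, (0 : ℝ)) hN (hl (t, 0))).fderiv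
  simp only [Function.comp_def] at hcomp
  rw [(hp _ _ (by simp) (by simp)).fderiv_eq, (hp _ _ (by simp) (by simp)).fderiv_eq, hcomp] at h1
  simp at h1
  linarith

/-- Clairaut's integral: `⟨γ', K⟩` is constant along a geodesic. -/
theorem IsKillingFlow.deriv_momentum {g : LorentzianMetric X} {K : ∀ p : X, TangentSpace (𝓡 2) p}
    {φ : ℝ → X → X} (h : IsKillingFlow g K φ) {γ : ℝ → X} {J : Set ℝ}
    (hγ : IsGeodesicOn g γ J) {t : ℝ} (ht : t ∈ J) : deriv (momentum g K γ) t = 0 := by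
  -- the variation of `γ` by the Killing flow
  have hO : IsOpen (J ×ˢ (univ : Set ℝ)) := hγ.isOpen.prod isOpen_univ
  have ht' : (t, (0 : ℝ)) ∈ J ×ˢ (univ : Set ℝ) := ⟨ht, mem_univ _⟩
  have h1 := geodesicDefect_eq g hO (h.contMDiffOn_flowMap hγ.contMDiffOn) ht'
  have h2 : (fun s ↦ flowMap φ γ (s, 0)) = γ := by funext s; simp [flowMap, h.map_zero]
  rw [h2, geodesicEquationAt_iff.1 (hγ.equation t ht)] at h1
  have hp : ∀ a b : ℝ × ℝ, (fun q ↦ pullMetric g (flowMap φ γ) q a b)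
      =ᶠ[𝓝 (t, (0 : ℝ))] fun q ↦ a.1 * b.1 * normSqVelocity g γ q.1
      + (a.1 * b.2 + a.2 * b.1) * momentum g K γ q.1
      + a.2 * b.2 * g.val (γ q.1) (K (γ q.1)) (K (γ q.1)) := by
    intro a b
    filter_upwards [hO.mem_nhds ht'] with q hq
    exact h.pullMetric_flowMap hγ.isOpen hγ.contMDiffOn hq.1 a b
  have hN := (((contDiffOn_normSqVelocity g hγ.isOpen hγ.contMDiffOn).contDiffAt
    (hγ.isOpen.mem_nhds ht)).differentiableAt (by simp)).hasDerivAt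
  have hM := (((h.contDiffOn_momentum hγ.isOpen hγ.contMDiffOn).contDiffAt
    (hγ.isOpen.mem_nhds ht)).differentiableAt (by simp)).hasDerivAt
  have hfst : HasFDerivAt (fun q : ℝ × ℝ ↦ q.1) (ContinuousLinearMap.fst ℝ ℝ ℝ) (t, (0 : ℝ)) :=
    hasFDerivAt_fst
  have hN' := (HasDerivAt.comp_hasFDerivAt (f := fun q : ℝ × ℝ ↦ q.1) (t, (0 : ℝ)) hN hfst).fderiv
  have hM' := (HasDerivAt.comp_hasFDerivAt (f := fun q : ℝ × ℝ ↦ q.1) (t, (0 : ℝ)) hM hfst).fderiv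
  simp only [Function.comp_def] at hN' hM'
  rw [(hp _ _).fderiv_eq, (hp _ _).fderiv_eq] at h1
  simp only [mul_one, mul_zero, one_mul, zero_mul, add_zero, zero_add] at h1
  rw [hN', hM'] at h1
  simpa using h1.symm

theorem IsGeodesicOn.normSqVelocity_eq {g : LorentzianMetric X} {γ : ℝ → X} {J : Set ℝ}
    (hγ : IsGeodesicOn g γ J) {s t : ℝ} (hs : s ∈ J) (ht : t ∈ J) :
    normSqVelocity g γ s = normSqVelocity g γ t :=
  hγ.isOpen.is_const_of_deriv_eq_zero hγ.ordConnected.isPreconnected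
    ((contDiffOn_normSqVelocity g hγ.isOpen hγ.contMDiffOn).differentiableOn (by simp))
    (fun _ hr ↦ hγ.deriv_normSqVelocity hr) hs ht

theorem IsKillingFlow.momentum_eq {g : LorentzianMetric X} {K : ∀ p : X, TangentSpace (𝓡 2) p}
    {φ : ℝ → X → X} (h : IsKillingFlow g K φ) {γ : ℝ → X} {J : Set ℝ}
    (hγ : IsGeodesicOn g γ J) {s t : ℝ} (hs : s ∈ J) (ht : t ∈ J) :
    momentum g K γ s = momentum g K γ t :=
  hγ.isOpen.is_const_of_deriv_eq_zero hγ.ordConnected.isPreconnected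
    ((h.contDiffOn_momentum hγ.isOpen hγ.contMDiffOn).differentiableOn (by simp))
    (fun _ hr ↦ h.deriv_momentum hγ hr) hs ht

end Surface

/-! ### Null curves transverse to the Killing field -/

section Surface

variable {X : Type*} [TopologicalSpace X] [ChartedSpace Plane X] [IsManifold (𝓡 2) ∞ X]

/-- `c` is, on `I`, a smooth null curve with `⟨c', K⟩ = σ`, parametrized by the transverse
coordinate `x`. -/
structure IsNullTransversalOn (g : LorentzianMetric X) (K : ∀ p : X, TangentSpace (𝓡 2) p)
    (x : X → ℝ) (σ : ℝ) (c : ℝ → X) (I : Set ℝ) : Prop where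
  contMDiffOn : ContMDiffOn 𝓘(ℝ, ℝ) (𝓡 2) ∞ c I
  normSq_eq : ∀ s ∈ I, normSqVelocity g c s = 0
  momentum_eq : ∀ s ∈ I, momentum g K c s = σ
  coord_eq : ∀ s ∈ I, x (c s) = s

theorem pullMetric_comp (g : LorentzianMetric X) {E E' : Type*} [NormedAddCommGroup E]
    [NormedSpace ℝ E] [NormedAddCommGroup E'] [NormedSpace ℝ E'] {Φ : E → X} {P : E' → E}
    {P' : E' →L[ℝ] E} {q : E'} (hΦ : MDifferentiableAt 𝓘(ℝ, E) (𝓡 2) Φ (P q))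
    (hP : HasFDerivAt P P' q) (v w : E') :
    pullMetric g (fun q ↦ Φ (P q)) q v w = pullMetric g Φ (P q) (P' v) (P' w) := by
  have h1 := (HasMFDerivAt.comp q hΦ.hasMFDerivAt hP.hasMFDerivAt).mfderiv
  exact congrArg (fun A : E' →L[ℝ] Plane ↦
    (g.val (Φ (P q)) : Plane →L[ℝ] Plane →L[ℝ] ℝ) (A v) (A w)) h1

theorem fderiv_apply_one_zero {V : Type*} [NormedAddCommGroup V] [NormedSpace ℝ V]
    {F : ℝ × ℝ → V} {t r : ℝ} (hF : DifferentiableAt ℝ F (t, r)) :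
    fderiv ℝ F (t, r) (1, 0) = deriv (fun s ↦ F (s, r)) t := by
  have h := HasFDerivAt.comp_hasDerivAt (f := fun s : ℝ ↦ (s, r)) t hF.hasFDerivAt
    ((hasDerivAt_id t).prodMk (hasDerivAt_const t r))
  exact h.deriv.symm

theorem fderiv_apply_zero_one {V : Type*} [NormedAddCommGroup V] [NormedSpace ℝ V]
    {F : ℝ × ℝ → V} {t r : ℝ} (hF : DifferentiableAt ℝ F (t, r)) :
    fderiv ℝ F (t, r) (0, 1) = deriv (fun s ↦ F (t, s)) r := by
  have h := HasFDerivAt.comp_hasDerivAt (f := fun s : ℝ ↦ (t, s)) r hF.hasFDerivAt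
    ((hasDerivAt_const r t).prodMk (hasDerivAt_id r))
  exact h.deriv.symm

section

variable {g : LorentzianMetric X} {K : ∀ p : X, TangentSpace (𝓡 2) p} {φ : ℝ → X → X}
  {x : X → ℝ} {σ : ℝ} {c : ℝ → X} {I : Set ℝ}

/-- In the coordinates `(s, t)` given by the flow of `K` and a null transversal, the metric reads
`2 σ ds dt + ⟨K, K⟩ dt²`. -/
theorem IsNullTransversalOn.pullMetric_flowMap (hc : IsNullTransversalOn g K x σ c I)
    (h : IsKillingFlow g K φ) (hI : IsOpen I) {q : ℝ × ℝ} (hq : q.1 ∈ I) (v w : ℝ × ℝ) :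
    pullMetric g (flowMap φ c) q v w = σ * (v.1 * w.2 + v.2 * w.1)
      + g.val (c q.1) (K (c q.1)) (K (c q.1)) * (v.2 * w.2) := by
  rw [h.pullMetric_flowMap hI hc.contMDiffOn hq, hc.normSq_eq _ hq, hc.momentum_eq _ hq]
  ring

theorem IsNullTransversalOn.mfderiv_flowMap_bijective (hc : IsNullTransversalOn g K x σ c I)
    (hσ : σ ≠ 0) (h : IsKillingFlow g K φ) (hI : IsOpen I) {q : ℝ × ℝ} (hq : q.1 ∈ I) :
    Function.Bijective (mfderiv 𝓘(ℝ, ℝ × ℝ) (𝓡 2) (flowMap φ c) q : ℝ × ℝ →L[ℝ] Plane) := by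
  set A : ℝ × ℝ →L[ℝ] Plane := mfderiv 𝓘(ℝ, ℝ × ℝ) (𝓡 2) (flowMap φ c) q with hA
  have hinj : Function.Injective A := by
    rw [injective_iff_map_eq_zero]
    intro v hv
    have h0 : ∀ w, pullMetric g (flowMap φ c) q v w = 0 := by
      intro w
      let B : Plane →L[ℝ] Plane →L[ℝ] ℝ := g.val (flowMap φ c q)
      change B (A v) (A w) = 0
      rw [hv, map_zero, zero_apply]
    have h1 := h0 (1, 0)
    have h2 := h0 (0, 1)
    rw [hc.pullMetric_flowMap h hI hq] at h1 h2
    have h3 : v.2 = 0 := by simpa [hσ] using h1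
    have h4 : v.1 = 0 := by simpa [hσ, h3] using h2
    exact Prod.ext h4 h3
  refine ⟨hinj, ?_⟩
  have hfin : Module.finrank ℝ (ℝ × ℝ) = Module.finrank ℝ Plane := by simp
  exact (LinearMap.injective_iff_surjective_of_finrank_eq_finrank (f := A.toLinearMap) hfin).1 hinj

/-- The geodesic equations of the metric `2 σ ds dt + k(s) dt²`, where `k = ⟨K, K⟩ ∘ c`: a solution
`(p₁, p₂)`, with derivative `(v₁, v₂)`, gives a geodesic of `X`. -/
theorem IsNullTransversalOn.isGeodesicOn (hc : IsNullTransversalOn g K x σ c I)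
    (hσ : σ ^ 2 = 1) (h : IsKillingFlow g K φ) (hI : IsOpen I) {J : Set ℝ} (hJ : IsOpen J)
    (hJc : J.OrdConnected) (hJn : J.Nonempty) {p₁ p₂ v₁ v₂ : ℝ → ℝ}
    (hp₁ : ContDiffOn ℝ ∞ p₁ J) (hp₂ : ContDiffOn ℝ ∞ p₂ J) (hp : MapsTo p₁ J I)
    (hv₁ : ∀ t ∈ J, HasDerivAt p₁ (v₁ t) t) (hv₂ : ∀ t ∈ J, HasDerivAt p₂ (v₂ t) t)
    (hmom : ∀ t ∈ J, HasDerivAt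
      (fun t ↦ σ * v₁ t + g.val (c (p₁ t)) (K (c (p₁ t))) (K (c (p₁ t))) * v₂ t) 0 t)
    (hacc : ∀ t ∈ J, HasDerivAt v₂
      (σ / 2 * deriv (fun s ↦ g.val (c s) (K (c s)) (K (c s))) (p₁ t) * v₂ t ^ 2) t) :
    IsGeodesicOn g (fun t ↦ flowMap φ c (p₁ t, p₂ t)) J := by
  have hΦ := h.contMDiffOn_flowMap hc.contMDiffOn
  refine ⟨hJ, hJc, hJn, ?_, ?_⟩
  · exact hΦ.comp (hp₁.prodMk hp₂).contMDiffOn fun t ht ↦ ⟨hp ht, mem_univ _⟩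
  intro t ht
  rw [geodesicEquationAt_iff]
  intro w
  set k : ℝ → ℝ := fun s ↦ g.val (c s) (K (c s)) (K (c s)) with hk
  have hσ0 : σ ≠ 0 := by rintro rfl; simp at hσ
  have hkd : ∀ s ∈ I, DifferentiableAt ℝ k s := fun s hs ↦
    ((h.contDiffOn_field hI hc.contMDiffOn).contDiffAt (hI.mem_nhds hs)).differentiableAt (by simp)
  have hpt : (p₁ t, p₂ t) ∈ I ×ˢ (univ : Set ℝ) := ⟨hp ht, mem_univ _⟩
  set e := extChartAt (𝓡 2) (flowMap φ c (p₁ t, p₂ t)) with he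
  have hΦt : MDifferentiableAt 𝓘(ℝ, ℝ × ℝ) (𝓡 2) (flowMap φ c) (p₁ t, p₂ t) :=
    (hΦ.contMDiffAt ((hI.prod isOpen_univ).mem_nhds hpt)).mdifferentiableAt (by simp)
  have het : MDifferentiableAt (𝓡 2) 𝓘(ℝ, Plane) e (flowMap φ c (p₁ t, p₂ t)) :=
    mdifferentiableAt_extChartAt (mem_chart_source _ _)
  have heΦ := HasMFDerivAt.comp (p₁ t, p₂ t) het.hasMFDerivAt hΦt.hasMFDerivAt
  -- every direction `w` is the image of some `(a, b)` under the differential of `flowMap φ c`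
  obtain ⟨⟨a, b⟩, hab⟩ : ∃ v : ℝ × ℝ,
      (fderiv ℝ (fun q ↦ e (flowMap φ c q)) (p₁ t, p₂ t)) v = w := by
    have h1 : Function.Surjective (mfderiv (𝓡 2) 𝓘(ℝ, Plane) e (flowMap φ c (p₁ t, p₂ t))) :=
      (isInvertible_mfderiv_extChartAt (mem_extChartAt_source _)).bijective.surjective
    have h2 := (hc.mfderiv_flowMap_bijective hσ0 h hI (q := (p₁ t, p₂ t)) (hp ht)).surjective
    have h3 := heΦ.mfderiv
    rw [mfderiv_eq_fderiv] at h3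
    obtain ⟨v, hv⟩ := h1.comp h2 w
    exact ⟨v, (congrArg (fun A : ℝ × ℝ →L[ℝ] Plane ↦ A v) h3).trans hv⟩
  -- the first variation formula is applied to the variation of the curve in the direction `(a, b)`
  let P : ℝ × ℝ → ℝ × ℝ := fun q ↦ (p₁ q.1 + q.2 * a, p₂ q.1 + q.2 * b)
  set O : Set (ℝ × ℝ) := (J ×ˢ univ) ∩ (fun q : ℝ × ℝ ↦ p₁ q.1 + q.2 * a) ⁻¹' I with hOdef
  have hc1 : ContDiffOn ℝ ∞ (fun q : ℝ × ℝ ↦ p₁ q.1 + q.2 * a) (J ×ˢ univ) :=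
    (hp₁.comp contDiff_fst.contDiffOn fun q hq ↦ hq.1).add
      (contDiff_snd.mul contDiff_const).contDiffOn
  have hc2 : ContDiffOn ℝ ∞ (fun q : ℝ × ℝ ↦ p₂ q.1 + q.2 * b) (J ×ˢ univ) :=
    (hp₂.comp contDiff_fst.contDiffOn fun q hq ↦ hq.1).add
      (contDiff_snd.mul contDiff_const).contDiffOn
  have hO : IsOpen O := hc1.continuousOn.isOpen_inter_preimage (hJ.prod isOpen_univ) hI
  have htO : (t, (0 : ℝ)) ∈ O := ⟨⟨ht, mem_univ _⟩, by simpa using hp ht⟩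
  have hPI : ∀ q ∈ O, (P q).1 ∈ I := fun q hq ↦ hq.2
  have hH : ContMDiffOn 𝓘(ℝ, ℝ × ℝ) (𝓡 2) ∞ (fun q ↦ flowMap φ c (P q)) O :=
    hΦ.comp ((hc1.prodMk hc2).mono inter_subset_left).contMDiffOn fun q hq ↦ ⟨hPI q hq, mem_univ _⟩
  have h1 := geodesicDefect_eq g hO hH htO
  have h2 : (fun s ↦ flowMap φ c (P (s, 0))) = fun t ↦ flowMap φ c (p₁ t, p₂ t) := by
    funext s; simp [P]
  have h3 : P (t, 0) = (p₁ t, p₂ t) := by simp [P]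
  have hab' : fderiv ℝ (fun q ↦ e (flowMap φ c (P q))) (t, 0) (0, 1) = w := by
    have hd : MDifferentiableAt (𝓡 2) 𝓘(ℝ, Plane) e (flowMap φ c (P (t, 0))) := by rwa [h3]
    have hd' : DifferentiableAt ℝ (fun q ↦ e (flowMap φ c (P q))) (t, 0) := (hd.comp (t, (0 : ℝ))
      ((hH.contMDiffAt (hO.mem_nhds htO)).mdifferentiableAt (by simp))).differentiableAt
    rw [fderiv_apply_zero_one hd', ← hab]
    have h5 : HasDerivAt (fun r : ℝ ↦ P (t, r)) (a, b) 0 := by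
      have h6 : ∀ u z : ℝ, HasDerivAt (fun r : ℝ ↦ u + r * z) z 0 := fun u z ↦ by
        simpa using ((hasDerivAt_id (0 : ℝ)).mul_const z).const_add u
      exact HasDerivAt.prodMk (h6 (p₁ t) a) (h6 (p₂ t) b)
    have h7 : DifferentiableAt ℝ (fun q ↦ e (flowMap φ c q)) (P (t, 0)) := by
      rw [h3]
      exact heΦ.mdifferentiableAt.differentiableAt
    have h8 := HasFDerivAt.comp_hasDerivAt (f := fun r : ℝ ↦ P (t, r)) (0 : ℝ) h7.hasFDerivAt h5
    rw [h3] at h8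
    exact h8.deriv
  rw [h2, h3, hab'] at h1
  rw [h1]
  have hpull : ∀ q ∈ O, ∀ v w : ℝ × ℝ, pullMetric g (fun q ↦ flowMap φ c (P q)) q v w
      = σ * ((v₁ q.1 * v.1 + v.2 * a) * (v₂ q.1 * w.1 + w.2 * b)
          + (v₂ q.1 * v.1 + v.2 * b) * (v₁ q.1 * w.1 + w.2 * a))
        + k (p₁ q.1 + q.2 * a) * ((v₂ q.1 * v.1 + v.2 * b) * (v₂ q.1 * w.1 + w.2 * b)) := by
    intro q hq v w
    have hPd : HasFDerivAt P
        (((v₁ q.1 • ContinuousLinearMap.fst ℝ ℝ ℝ) + a • ContinuousLinearMap.snd ℝ ℝ ℝ).prod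
        ((v₂ q.1 • ContinuousLinearMap.fst ℝ ℝ ℝ) + b • ContinuousLinearMap.snd ℝ ℝ ℝ)) q :=
      ((HasDerivAt.comp_hasFDerivAt (f := fun q : ℝ × ℝ ↦ q.1) q (hv₁ q.1 hq.1.1)
          hasFDerivAt_fst).add (hasFDerivAt_snd.mul_const a)).prodMk
        ((HasDerivAt.comp_hasFDerivAt (f := fun q : ℝ × ℝ ↦ q.1) q (hv₂ q.1 hq.1.1)
          hasFDerivAt_fst).add (hasFDerivAt_snd.mul_const b))
    have hd : MDifferentiableAt 𝓘(ℝ, ℝ × ℝ) (𝓡 2) (flowMap φ c) (P q) :=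
      (hΦ.contMDiffAt ((hI.prod isOpen_univ).mem_nhds ⟨hPI q hq, mem_univ _⟩)).mdifferentiableAt
        (by simp)
    rw [pullMetric_comp g hd hPd, hc.pullMetric_flowMap h hI (hPI q hq)]
    simp [P, k]
    ring
  have hdiff : ∀ v w : ℝ × ℝ, DifferentiableAt ℝ
      (fun q ↦ pullMetric g (fun q ↦ flowMap φ c (P q)) q v w) (t, 0) := fun v w ↦
    ((contDiffOn_pullMetric g hO hH v w).contDiffAt (hO.mem_nhds htO)).differentiableAt (by simp)
  rw [fderiv_apply_one_zero (hdiff _ _), fderiv_apply_zero_one (hdiff _ _)]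
  have hl1 : ∀ᶠ s in 𝓝 t, (s, (0 : ℝ)) ∈ O :=
    (Continuous.prodMk_left (0 : ℝ)).continuousAt.eventually (hO.mem_nhds htO)
  have hl2 : ∀ᶠ r in 𝓝 (0 : ℝ), (t, r) ∈ O :=
    (Continuous.prodMk_right t).continuousAt.eventually (hO.mem_nhds htO)
  have hd1 : HasDerivAt (fun s ↦ pullMetric g (fun q ↦ flowMap φ c (P q)) (s, 0) (1, 0) (0, 1))
      (b * 0 + a * (σ * (σ / 2 * deriv k (p₁ t) * v₂ t ^ 2))) t := by
    refine (((hmom t ht).const_mul b).add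
      (((hacc t ht).const_mul σ).const_mul a)).congr_of_eventuallyEq ?_
    filter_upwards [hl1] with s hs
    rw [hpull _ hs]
    simp [hk]
    ring
  have hd2 : HasDerivAt (fun r ↦ pullMetric g (fun q ↦ flowMap φ c (P q)) (t, r) (1, 0) (1, 0))
      (0 + deriv k (p₁ t) * a * v₂ t ^ 2) 0 := by
    have hkk : HasDerivAt (fun r : ℝ ↦ k (p₁ t + r * a)) (deriv k (p₁ t) * a) 0 := by
      have h5 : HasDerivAt (fun r : ℝ ↦ p₁ t + r * a) a 0 := by
        simpa using ((hasDerivAt_id (0 : ℝ)).mul_const a).const_add (p₁ t)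
      have h6 : HasDerivAt k (deriv k (p₁ t)) (p₁ t + 0 * a) := by
        simpa using (hkd _ (hp ht)).hasDerivAt
      exact HasDerivAt.comp (h := fun r : ℝ ↦ p₁ t + r * a) (0 : ℝ) h6 h5
    refine ((hasDerivAt_const (0 : ℝ) (2 * σ * v₁ t * v₂ t)).add
      (hkk.mul_const (v₂ t ^ 2))).congr_of_eventuallyEq ?_
    filter_upwards [hl2] with r hr
    rw [hpull _ hr]
    simp
    ring
  rw [hd1.deriv, hd2.deriv]
  linear_combination (a * deriv k (p₁ t) * v₂ t ^ 2 / 2) * hσ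

end
end Surface

/-! ### The transverse coordinate -/

/-- The derivative of the function `x` in the direction `v`. -/
noncomputable def coordDeriv {X : Type*} [TopologicalSpace X] [ChartedSpace Plane X]
    (x : X → ℝ) (p : X) : TangentSpace (𝓡 2) p →L[ℝ] ℝ :=
  mfderiv (𝓡 2) 𝓘(ℝ, ℝ) x p

theorem hasDerivAt_comp_curve {X : Type*} [TopologicalSpace X] [ChartedSpace Plane X]
    {x : X → ℝ} {γ : ℝ → X} {t : ℝ}
    (hx : MDifferentiableAt (𝓡 2) 𝓘(ℝ, ℝ) x (γ t)) (hγ : MDifferentiableAt 𝓘(ℝ, ℝ) (𝓡 2) γ t) :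
    HasDerivAt (fun s ↦ x (γ s)) (coordDeriv x (γ t) (velocity γ t)) t :=
  (show HasFDerivAt (fun s ↦ x (γ s)) ((coordDeriv x (γ t) : Plane →L[ℝ] ℝ).comp
      (mfderiv 𝓘(ℝ, ℝ) (𝓡 2) γ t : ℝ →L[ℝ] Plane)) t from
    (HasMFDerivAt.comp t hx.hasMFDerivAt hγ.hasMFDerivAt).hasFDerivAt).hasDerivAt

section Surface

variable {X : Type*} [TopologicalSpace X] [ChartedSpace Plane X] [IsManifold (𝓡 2) ∞ X]

theorem normSqVelocity_congr (g : LorentzianMetric X) {γ γ' : ℝ → X} {t : ℝ} (h : γ =ᶠ[𝓝 t] γ') :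
    normSqVelocity g γ t = normSqVelocity g γ' t := by
  have hval : ∀ (p₁ p₂ : X) (_ : p₁ = p₂) (a b : Plane), a = b → g.val p₁ a a = g.val p₂ b b := by
    rintro p₁ _ rfl a _ rfl
    rfl
  exact hval _ _ h.self_of_nhds _ _
    (congrArg (fun A : ℝ →L[ℝ] Plane ↦ A 1) (h.mfderiv_eq (I := 𝓘(ℝ, ℝ)) (I' := 𝓡 2)))

theorem momentum_congr (g : LorentzianMetric X) (K : ∀ p : X, TangentSpace (𝓡 2) p)
    {γ γ' : ℝ → X} {t : ℝ} (h : γ =ᶠ[𝓝 t] γ') : momentum g K γ t = momentum g K γ' t := by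
  have hval : ∀ (p₁ p₂ : X) (_ : p₁ = p₂) (a b : Plane), a = b →
      g.val p₁ a (K p₁) = g.val p₂ b (K p₂) := by
    rintro p₁ _ rfl a _ rfl
    rfl
  exact hval _ _ h.self_of_nhds _ _
    (congrArg (fun A : ℝ →L[ℝ] Plane ↦ A 1) (h.mfderiv_eq (I := 𝓘(ℝ, ℝ)) (I' := 𝓡 2)))

section

variable {g : LorentzianMetric X} {K : ∀ p : X, TangentSpace (𝓡 2) p} {φ : ℝ → X → X}
  {x : X → ℝ} {σ : ℝ} {c : ℝ → X} {I : Set ℝ}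

theorem IsTransverseCoordinate.mdifferentiableAt (hx : IsTransverseCoordinate g K x) (p : X) :
    MDifferentiableAt (𝓡 2) 𝓘(ℝ, ℝ) x p :=
  hx.1.mdifferentiable (by simp) p

theorem IsTransverseCoordinate.coordDeriv_sq (hx : IsTransverseCoordinate g K x) (p : X)
    (v : TangentSpace (𝓡 2) p) : coordDeriv x p v ^ 2
      = g.val p (K p) v ^ 2 - g.val p (K p) (K p) * g.val p v v :=
  hx.2 p v

theorem IsTransverseCoordinate.coordDeriv_field (hx : IsTransverseCoordinate g K x) (p : X) :
    coordDeriv x p (K p) = 0 := by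
  have := hx.coordDeriv_sq p (K p)
  have h2 : coordDeriv x p (K p) ^ 2 = 0 := by rw [this]; ring
  exact pow_eq_zero_iff (two_ne_zero) |>.1 h2

theorem IsTransverseCoordinate.coordDeriv_velocity_sq (hx : IsTransverseCoordinate g K x)
    (γ : ℝ → X) (t : ℝ) : coordDeriv x (γ t) (velocity γ t) ^ 2
      = momentum g K γ t ^ 2 - g.val (γ t) (K (γ t)) (K (γ t)) * normSqVelocity g γ t := by
  rw [hx.coordDeriv_sq, g.symm]
  rfl

/-- The transverse coordinate is invariant by the flow of `K`. -/
theorem IsKillingFlow.coord_eq (h : IsKillingFlow g K φ) (hx : IsTransverseCoordinate g K x)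
    (t : ℝ) (p : X) : x (φ t p) = x p := by
  have hd : ∀ t, HasDerivAt (fun s ↦ x (φ s p)) 0 t := by
    intro t
    have h1 := hasDerivAt_comp_curve (γ := fun s ↦ φ s p) (hx.mdifferentiableAt _)
      (h.isMIntegralCurve p t).mdifferentiableAt
    rw [h.velocity_flow, hx.coordDeriv_field] at h1
    exact h1
  have := is_const_of_deriv_eq_zero (fun t ↦ (hd t).differentiableAt) (fun t ↦ (hd t).deriv) t 0
  simpa [h.map_zero] using this

theorem IsNullTransversalOn.isGeodesicOn_self (hc : IsNullTransversalOn g K x σ c I)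
    (hσ : σ ^ 2 = 1) (h : IsKillingFlow g K φ) (hI : IsOpen I) (hIc : I.OrdConnected)
    (hIn : I.Nonempty) : IsGeodesicOn g c I := by
  have := hc.isGeodesicOn hσ h hI hI hIc hIn (p₁ := id) (p₂ := fun _ ↦ 0) (v₁ := fun _ ↦ 1)
    (v₂ := fun _ ↦ 0) contDiffOn_id contDiffOn_const (mapsTo_id I) (fun t _ ↦ hasDerivAt_id t)
    (fun t _ ↦ hasDerivAt_const t 0) (fun t _ ↦ by simpa using hasDerivAt_const t (σ : ℝ))
    (fun t _ ↦ by simpa using hasDerivAt_const t (0 : ℝ))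
  simpa [flowMap, h.map_zero] using this

/-- Along a null transversal the null geodesic equation holds, so that by null completeness it
extends to a null transversal which is defined on `ℝ`. -/
theorem IsNullTransversalOn.exists_extension (hc : IsNullTransversalOn g K x σ c I)
    (hσ : σ ^ 2 = 1) (h : IsKillingFlow g K φ) (hx : IsTransverseCoordinate g K x)
    (hg : IsNullComplete g) (hI : IsOpen I) (hIc : I.OrdConnected) (hIn : I.Nonempty) :
    ∃ c' : ℝ → X, IsNullTransversalOn g K x σ c' univ ∧ EqOn c c' I := by
  obtain ⟨c', hc', heq⟩ := hg c I (hc.isGeodesicOn_self hσ h hI hIc hIn) fun t ht ↦ by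
    refine ⟨fun h0 ↦ ?_, hc.normSq_eq t ht⟩
    have h1 := hc.momentum_eq t ht
    rw [momentum, h0, map_zero] at h1
    rw [← h1] at hσ
    simp at hσ
  obtain ⟨s₀, hs₀⟩ := hIn
  have hev : c' =ᶠ[𝓝 s₀] c := by
    filter_upwards [hI.mem_nhds hs₀] with s hs using (heq hs).symm
  have hN : ∀ s, normSqVelocity g c' s = 0 := fun s ↦ by
    rw [hc'.normSqVelocity_eq (mem_univ s) (mem_univ s₀), normSqVelocity_congr g hev,
      hc.normSq_eq _ hs₀]
  have hM : ∀ s, momentum g K c' s = σ := fun s ↦ by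
    rw [h.momentum_eq hc' (mem_univ s) (mem_univ s₀), momentum_congr g K hev,
      hc.momentum_eq _ hs₀]
  have hsm : ContMDiff 𝓘(ℝ, ℝ) (𝓡 2) ∞ c' := contMDiffOn_univ.1 hc'.contMDiffOn
  have hd : ∀ s, HasDerivAt (fun s ↦ x (c' s)) (coordDeriv x (c' s) (velocity c' s)) s := fun s ↦
    hasDerivAt_comp_curve (hx.mdifferentiableAt _) (hsm.mdifferentiable (by simp) s)
  have hsq : ∀ s, deriv (fun s ↦ x (c' s)) s ^ 2 = 1 := fun s ↦ by
    rw [(hd s).deriv, hx.coordDeriv_velocity_sq, hM, hN, hσ, mul_zero, sub_zero]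
  have hcont : Continuous (deriv fun s ↦ x (c' s)) :=
    (hx.1.comp hsm).contDiff.continuous_deriv (by simp)
  have h0 : deriv (fun s ↦ x (c' s)) s₀ = 1 := by
    have : (fun s ↦ x (c' s)) =ᶠ[𝓝 s₀] id := by
      filter_upwards [hI.mem_nhds hs₀] with s hs
      rw [← heq hs, hc.coord_eq s hs]
      rfl
    rw [this.deriv_eq]
    simp
  have h1 : ∀ s, deriv (fun s ↦ x (c' s)) s = 1 := fun s ↦
    isPreconnected_univ.eq_of_sq_eq (g := fun _ ↦ (1 : ℝ)) hcont.continuousOn continuousOn_const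
      (fun s _ ↦ by simpa using hsq s) (fun _ ↦ one_ne_zero) (mem_univ s₀) h0 (mem_univ s)
  have h2 : ∀ s, x (c' s) - s = x (c' s₀) - s₀ := fun s ↦
    is_const_of_deriv_eq_zero (f := fun s ↦ x (c' s) - s)
      (fun s ↦ (hd s).differentiableAt.sub differentiableAt_id) (fun s ↦ by
        have := ((hd s).sub (hasDerivAt_id s)).deriv
        have h3 := (hd s).deriv.symm.trans (h1 s)
        rw [h3, sub_self] at this
        exact this) s s₀
  refine ⟨c', ⟨hc'.contMDiffOn, fun s _ ↦ hN s, fun s _ ↦ hM s, fun s _ ↦ ?_⟩, heq⟩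
  have h3 : x (c' s₀) = s₀ := by rw [← heq hs₀, hc.coord_eq _ hs₀]
  linarith [h2 s]

end
end Surface

/-! ### Coordinates given by a null transversal -/

section Surface

variable {X : Type*} [TopologicalSpace X] [ChartedSpace Plane X] [IsManifold (𝓡 2) ∞ X]

/-- The inverse function theorem for a map from a normed space to a surface. -/
theorem exists_contMDiffAt_rightInverse {E : Type*} [NormedAddCommGroup E] [NormedSpace ℝ E]
    [CompleteSpace E] {H : E → X} {q : E} (hH : ContMDiffAt 𝓘(ℝ, E) (𝓡 2) ∞ H q)
    (hb : Function.Bijective (mfderiv 𝓘(ℝ, E) (𝓡 2) H q : E →L[ℝ] Plane)) :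
    ∃ Ψ : X → E, ContMDiffAt (𝓡 2) 𝓘(ℝ, E) ∞ Ψ (H q) ∧ Ψ (H q) = q ∧
      ∀ᶠ p in 𝓝 (H q), H (Ψ p) = p := by
  set e := extChartAt (𝓡 2) (H q) with he
  let D : Plane →L[ℝ] Plane := mfderiv (𝓡 2) 𝓘(ℝ, Plane) e (H q)
  let A : E →L[ℝ] Plane := mfderiv 𝓘(ℝ, E) (𝓡 2) H q
  have hD : Function.Bijective D :=
    (isInvertible_mfderiv_extChartAt (mem_extChartAt_source (H q))).bijective
  have hDA : Function.Bijective (D.comp A) := hD.comp hb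
  have hf : ContDiffAt ℝ ∞ (fun q ↦ e (H q)) q :=
    (ContMDiffAt.comp q (contMDiffAt_extChartAt (n := ∞)) hH).contDiffAt
  have hd : HasFDerivAt (fun q ↦ e (H q)) (D.comp A) q :=
    (HasMFDerivAt.comp q (mdifferentiableAt_extChartAt (mem_chart_source _ _)).hasMFDerivAt
      (hH.mdifferentiableAt (by simp)).hasMFDerivAt).hasFDerivAt
  let f' : E ≃L[ℝ] Plane := ContinuousLinearEquiv.ofBijective (D.comp A)
    (LinearMap.ker_eq_bot.2 hDA.1) (LinearMap.range_eq_top.2 hDA.2)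
  have hd' : HasFDerivAt (fun q ↦ e (H q)) (f' : E →L[ℝ] Plane) q := by
    rwa [ContinuousLinearEquiv.coe_ofBijective]
  have hn : (∞ : WithTop ℕ∞) ≠ 0 := by simp
  let Λ := hf.localInverse hd' hn
  have hΛ : ContDiffAt ℝ ∞ Λ (e (H q)) := hf.to_localInverse hd' hn
  have hΛq : Λ (e (H q)) = q := hf.localInverse_apply_image hd' hn
  have hΨ : ContMDiffAt (𝓡 2) 𝓘(ℝ, E) ∞ (fun p ↦ Λ (e p)) (H q) :=
    ContMDiffAt.comp (H q) hΛ.contMDiffAt (contMDiffAt_extChartAt (n := ∞))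
  refine ⟨fun p ↦ Λ (e p), hΨ, hΛq, ?_⟩
  have h1 : ∀ᶠ z in 𝓝 (e (H q)), e (H (Λ z)) = z :=
    (hf.hasStrictFDerivAt' hd' hn).eventually_right_inverse
  have h2 : ∀ᶠ p in 𝓝 (H q), e (H (Λ (e p))) = e p :=
    (contMDiffAt_extChartAt (I := 𝓡 2) (n := ∞)).continuousAt.eventually h1
  have h3 : ContinuousAt (fun p ↦ H (Λ (e p))) (H q) := by
    refine ContinuousAt.comp (g := H) ?_ hΨ.continuousAt
    rw [hΛq]
    exact hH.continuousAt
  have h4 : ∀ᶠ p in 𝓝 (H q), H (Λ (e p)) ∈ e.source := by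
    refine h3.eventually_mem ?_
    rw [hΛq]
    exact extChartAt_source_mem_nhds (H q)
  filter_upwards [h2, h4, extChartAt_source_mem_nhds (I := 𝓡 2) (H q)] with p hp2 hp4 hp
  exact e.injOn hp4 hp hp2

section

variable {g : LorentzianMetric X} {K : ∀ p : X, TangentSpace (𝓡 2) p} {φ : ℝ → X → X}
  {x : X → ℝ} {σ : ℝ} {c c₁ c₂ : ℝ → X} {I : Set ℝ}

theorem IsKillingFlow.normSqVelocity_eq_pullMetric (h : IsKillingFlow g K φ) (hI : IsOpen I)
    (hc : ContMDiffOn 𝓘(ℝ, ℝ) (𝓡 2) ∞ c I) {s : ℝ} (hs : s ∈ I) :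
    normSqVelocity g c s = pullMetric g (flowMap φ c) (s, 0) (1, 0) (1, 0) := by
  rw [h.pullMetric_flowMap hI hc hs]
  simp

theorem IsKillingFlow.momentum_eq_pullMetric (h : IsKillingFlow g K φ) (hI : IsOpen I)
    (hc : ContMDiffOn 𝓘(ℝ, ℝ) (𝓡 2) ∞ c I) {s : ℝ} (hs : s ∈ I) :
    momentum g K c s = pullMetric g (flowMap φ c) (s, 0) (1, 0) (0, 1) := by
  rw [h.pullMetric_flowMap hI hc hs]
  simp

theorem IsNullTransversalOn.contMDiff (hc : IsNullTransversalOn g K x σ c univ) :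
    ContMDiff 𝓘(ℝ, ℝ) (𝓡 2) ∞ c := contMDiffOn_univ.1 hc.contMDiffOn

theorem IsNullTransversalOn.contMDiff_flowMap (hc : IsNullTransversalOn g K x σ c univ)
    (h : IsKillingFlow g K φ) : ContMDiff 𝓘(ℝ, ℝ × ℝ) (𝓡 2) ∞ (flowMap φ c) := by
  have := h.contMDiffOn_flowMap hc.contMDiffOn
  rwa [univ_prod_univ, contMDiffOn_univ] at this

theorem IsNullTransversalOn.coord_flowMap (hc : IsNullTransversalOn g K x σ c univ)
    (h : IsKillingFlow g K φ) (hx : IsTransverseCoordinate g K x) (q : ℝ × ℝ) :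
    x (flowMap φ c q) = q.1 := by
  rw [flowMap, h.coord_eq hx, hc.coord_eq _ (mem_univ _)]

/-- The coordinates given by a null transversal have smooth local inverses. -/
theorem IsNullTransversalOn.exists_rightInverse (hc : IsNullTransversalOn g K x σ c univ)
    (hσ : σ ^ 2 = 1) (h : IsKillingFlow g K φ) (q : ℝ × ℝ) :
    ∃ Ψ : X → ℝ × ℝ, ContMDiffAt (𝓡 2) 𝓘(ℝ, ℝ × ℝ) ∞ Ψ (flowMap φ c q) ∧ Ψ (flowMap φ c q) = q ∧
      ∀ᶠ p in 𝓝 (flowMap φ c q), flowMap φ c (Ψ p) = p :=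
  exists_contMDiffAt_rightInverse (hc.contMDiff_flowMap h q)
    (hc.mfderiv_flowMap_bijective (by rintro rfl; simp at hσ) h isOpen_univ (mem_univ _))

theorem IsNullTransversalOn.isOpenMap_flowMap (hc : IsNullTransversalOn g K x σ c univ)
    (hσ : σ ^ 2 = 1) (h : IsKillingFlow g K φ) : IsOpenMap (flowMap φ c) := by
  rw [isOpenMap_iff_nhds_le]
  intro q
  obtain ⟨Ψ, h1, h2, h3⟩ := hc.exists_rightInverse hσ h q
  intro s hs
  have h4 : ∀ᶠ p in 𝓝 (flowMap φ c q), Ψ p ∈ flowMap φ c ⁻¹' s := by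
    apply h1.continuousAt.eventually
    rw [h2]
    exact hs
  filter_upwards [h3, h4] with p hp hp'
  rw [← hp]
  exact hp'

/-- The flow of `K` moves null transversals to null transversals. -/
theorem IsNullTransversalOn.flow_comp (hc : IsNullTransversalOn g K x σ c univ)
    (h : IsKillingFlow g K φ) (hx : IsTransverseCoordinate g K x) (T : ℝ) :
    IsNullTransversalOn g K x σ (fun s ↦ φ T (c s)) univ := by
  have hsm : ContMDiff 𝓘(ℝ, ℝ) (𝓡 2) ∞ (fun s ↦ φ T (c s)) := (h.contMDiff_flow T).comp hc.contMDiff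
  have hP : ∀ q : ℝ × ℝ, HasFDerivAt (fun q : ℝ × ℝ ↦ (q.1, q.2 + T))
      (ContinuousLinearMap.id ℝ (ℝ × ℝ)) q := fun q ↦
    ((hasFDerivAt_id q).add_const (0, T)).congr_of_eventuallyEq
      (.of_forall fun q ↦ by ext <;> simp)
  have hΦ : flowMap φ (fun s ↦ φ T (c s)) = fun q ↦ flowMap φ c (q.1, q.2 + T) := by
    funext q
    simp [flowMap, h.map_add]
  have hpull : ∀ q v w, pullMetric g (flowMap φ (fun s ↦ φ T (c s))) q v w
      = σ * (v.1 * w.2 + v.2 * w.1)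
        + g.val (c q.1) (K (c q.1)) (K (c q.1)) * (v.2 * w.2) := by
    intro q v w
    rw [hΦ, pullMetric_comp g ((hc.contMDiff_flowMap h).mdifferentiable (by simp) _) (hP q),
      hc.pullMetric_flowMap h isOpen_univ (mem_univ _)]
    rfl
  refine ⟨hsm.contMDiffOn, fun s _ ↦ ?_, fun s _ ↦ ?_, fun s _ ↦ ?_⟩
  · rw [h.normSqVelocity_eq_pullMetric isOpen_univ hsm.contMDiffOn (mem_univ s), hpull]
    simp
  · rw [h.momentum_eq_pullMetric isOpen_univ hsm.contMDiffOn (mem_univ s), hpull]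
    simp
  · rw [h.coord_eq hx, hc.coord_eq _ (mem_univ _)]

/-- The direction of a null transversal is determined by `σ`, so that a null transversal is
determined by one of its points. -/
theorem IsNullTransversalOn.eq_of_apply_eq [T2Space X] (hc₁ : IsNullTransversalOn g K x σ c₁ univ)
    (hc₂ : IsNullTransversalOn g K x σ c₂ univ) (hσ : σ ^ 2 = 1) (h : IsKillingFlow g K φ)
    (hx : IsTransverseCoordinate g K x) {s₀ : ℝ} (heq : c₁ s₀ = c₂ s₀) : c₁ = c₂ := by
  have hσ0 : σ ≠ 0 := by rintro rfl; simp at hσ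
  have hopen : IsOpen {s | c₁ s = c₂ s} := by
    rw [isOpen_iff_mem_nhds]
    intro s₁ (hs₁ : c₁ s₁ = c₂ s₁)
    obtain ⟨Ψ, h1, h2, h3⟩ := hc₁.exists_rightInverse hσ h (s₁, 0)
    have hbase : flowMap φ c₁ (s₁, 0) = c₂ s₁ := by rw [flowMap, h.map_zero, hs₁]
    rw [hbase] at h1 h2 h3
    -- the second curve in the coordinates given by the first one is `(s, b s)`
    let b : ℝ → ℝ := fun s ↦ (Ψ (c₂ s)).2
    have hΨ1 : ContDiffAt ℝ ∞ (fun s ↦ Ψ (c₂ s)) s₁ :=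
      (ContMDiffAt.comp s₁ h1 (hc₂.contMDiff s₁)).contDiffAt
    have hbd : ∀ᶠ s in 𝓝 s₁, DifferentiableAt ℝ b s := by
      have := (hΨ1.of_le (m := 1) (by norm_cast)).eventually (by simp)
      filter_upwards [this] with s hs using (hs.differentiableAt (by simp)).snd
    have hval : ∀ᶠ s in 𝓝 s₁, φ (b s) (c₁ s) = c₂ s := by
      filter_upwards [(hc₂.contMDiff s₁).continuousAt.eventually h3] with s hs
      have h4 := hc₁.coord_flowMap h hx (Ψ (c₂ s))
      rw [hs, hc₂.coord_eq s (mem_univ s)] at h4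
      rw [flowMap, ← h4] at hs
      exact hs
    have hb0 : b s₁ = 0 := by simp [b, h2]
    obtain ⟨r, hr, hball⟩ := Metric.eventually_nhds_iff_ball.1 (hbd.and hval)
    have hderiv : ∀ s ∈ Metric.ball s₁ r, deriv b s = 0 := by
      intro s hs
      have hbs := (hball s hs).1.hasDerivAt
      have hP : HasFDerivAt (fun q : ℝ × ℝ ↦ (q.1, b q.1 + q.2))
          ((ContinuousLinearMap.fst ℝ ℝ ℝ).prod (deriv b s • ContinuousLinearMap.fst ℝ ℝ ℝ
            + ContinuousLinearMap.snd ℝ ℝ ℝ)) (s, 0) :=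
        hasFDerivAt_fst.prodMk ((HasDerivAt.comp_hasFDerivAt (f := fun q : ℝ × ℝ ↦ q.1)
          (s, (0 : ℝ)) hbs hasFDerivAt_fst).add hasFDerivAt_snd)
      have hev : flowMap φ c₂ =ᶠ[𝓝 (s, (0 : ℝ))] fun q ↦ flowMap φ c₁ (q.1, b q.1 + q.2) := by
        have hmem : ∀ᶠ q in 𝓝 (s, (0 : ℝ)), q.1 ∈ Metric.ball s₁ r :=
          continuous_fst.continuousAt.eventually (Metric.isOpen_ball.mem_nhds hs)
        filter_upwards [hmem] with q hq
        have := (hball _ hq).2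
        simp only [flowMap]
        rw [add_comm, h.map_add, this]
      have hpull : ∀ v w, pullMetric g (flowMap φ c₂) (s, 0) v w
          = pullMetric g (fun q : ℝ × ℝ ↦ flowMap φ c₁ (q.1, b q.1 + q.2)) (s, 0) v w := by
        intro v w
        have hval : ∀ (p₁ p₂ : X) (_ : p₁ = p₂) (A B : ℝ × ℝ →L[ℝ] Plane), A = B →
            g.val p₁ (A v) (A w) = g.val p₂ (B v) (B w) := by
          rintro p₁ _ rfl A _ rfl
          rfl
        exact hval _ _ hev.self_of_nhds _ _ (hev.mfderiv_eq (I := 𝓘(ℝ, ℝ × ℝ)) (I' := 𝓡 2))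
      have e1 := hpull (1, 0) (1, 0)
      have e2 := hpull (1, 0) (0, 1)
      rw [hc₂.pullMetric_flowMap h isOpen_univ (mem_univ _),
        pullMetric_comp g ((hc₁.contMDiff_flowMap h).mdifferentiable (by simp) _) hP,
        hc₁.pullMetric_flowMap h isOpen_univ (mem_univ _)] at e1 e2
      simp at e1 e2
      rcases e2 with e2 | e2
      · rw [e2] at e1
        have : σ * (2 * deriv b s) = 0 := by linarith
        simpa [hσ0] using this
      · exact e2
    filter_upwards [Metric.ball_mem_nhds s₁ hr] with s hs
    have h5 : b s = b s₁ := Metric.isOpen_ball.is_const_of_deriv_eq_zero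
      (convex_ball s₁ r).isPreconnected
      (fun s hs ↦ (hball s hs).1.differentiableWithinAt) hderiv hs (Metric.mem_ball_self hr)
    have h6 := (hball s hs).2
    rw [h5, hb0, h.map_zero] at h6
    exact h6
  have hclosed : IsClosed {s | c₁ s = c₂ s} :=
    isClosed_eq hc₁.contMDiff.continuous hc₂.contMDiff.continuous
  have := IsClopen.eq_univ ⟨hclosed, hopen⟩ ⟨s₀, heq⟩
  funext s
  exact this.ge (mem_univ s)

end
end Surface

/-! ### Null transversals through the points of a ribbon -/

/-- Solutions of a smooth autonomous differential equation are smooth. -/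
theorem contDiffOn_of_hasDerivAt_comp {F : Type*} [NormedAddCommGroup F] [NormedSpace ℝ F]
    {u : ℝ → F} {l : F → F} {V : Set F} {I : Set ℝ} (hI : IsOpen I) (hl : ContDiffOn ℝ ∞ l V)
    (hu : ∀ t ∈ I, HasDerivAt u (l (u t)) t) (huV : MapsTo u I V) : ContDiffOn ℝ ∞ u I := by
  rw [contDiffOn_infty]
  intro n
  induction n with
  | zero => exact contDiffOn_zero.2 fun t ht ↦ (hu t ht).continuousAt.continuousWithinAt
  | succ n ih =>
    push_cast
    rw [contDiffOn_succ_iff_deriv_of_isOpen hI]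
    refine ⟨fun t ht ↦ (hu t ht).differentiableAt.differentiableWithinAt, by simp, ?_⟩
    exact ((hl.of_le (by exact_mod_cast le_top)).comp ih huV).congr fun t ht ↦ (hu t ht).deriv

section Surface

variable {X : Type*} [TopologicalSpace X] [ChartedSpace Plane X] [IsManifold (𝓡 2) ∞ X]

theorem contMDiffOn_mfderiv_section {F : Type*} [NormedAddCommGroup F] [NormedSpace ℝ F]
    {f : X → F} {V : ∀ p : X, TangentSpace (𝓡 2) p} {O : Set X} (hO : IsOpen O)
    (hf : ContMDiffOn (𝓡 2) 𝓘(ℝ, F) ∞ f O)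
    (hV : ContMDiffOn (𝓡 2) (𝓡 2).tangent ∞ (fun p ↦ (⟨p, V p⟩ : TangentBundle (𝓡 2) X)) O) :
    ContMDiffOn (𝓡 2) 𝓘(ℝ, F) ∞ (fun p ↦ (mfderiv (𝓡 2) 𝓘(ℝ, F) f p (V p) : F)) O := by
  have h1 := hf.contMDiffOn_tangentMapWithin (m := ∞) (by simp) hO.uniqueMDiffOn
  have h2 := (contMDiff_snd_tangentBundle_modelSpace F 𝓘(ℝ, F)).comp_contMDiffOn
    (h1.comp hV fun q hq ↦ hq)
  exact h2.congr fun q hq ↦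
    congrArg (fun A : Plane →L[ℝ] F ↦ A (V q)) (mfderivWithin_of_isOpen hO hq).symm

/-- Integral curves of a smooth vector field are smooth. -/
theorem exists_contMDiffOn_integralCurve [T2Space X] {V : ∀ p : X, TangentSpace (𝓡 2) p} {O : Set X}
    (hO : IsOpen O)
    (hV : ContMDiffOn (𝓡 2) (𝓡 2).tangent ∞ (fun p ↦ (⟨p, V p⟩ : TangentBundle (𝓡 2) X)) O)
    {q : X} (hq : q ∈ O) (t₀ : ℝ) :
    ∃ (c : ℝ → X) (r : ℝ), 0 < r ∧ c t₀ = q ∧ MapsTo c (Metric.ball t₀ r) O ∧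
      ContMDiffOn 𝓘(ℝ, ℝ) (𝓡 2) ∞ c (Metric.ball t₀ r) ∧
      ∀ t ∈ Metric.ball t₀ r, velocity c t = V (c t) := by
  obtain ⟨c, hc0, hc⟩ := exists_isMIntegralCurveAt_of_contMDiffAt_boundaryless (I := 𝓡 2)
    (v := V) (x₀ := q) t₀ ((hV.contMDiffAt (hO.mem_nhds hq)).of_le (by norm_cast))
  set e := extChartAt (𝓡 2) q with he
  have h1 : ∀ᶠ t in 𝓝 t₀, c t ∈ O ∩ e.source := by
    refine hc.continuousAt.eventually_mem ?_
    rw [hc0]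
    exact inter_mem (hO.mem_nhds hq) (extChartAt_source_mem_nhds q)
  obtain ⟨r, hr, hball⟩ := Metric.eventually_nhds_iff_ball.1 (h1.and hc)
  refine ⟨c, r, hr, hc0, fun t ht ↦ (hball t ht).1.1, ?_, fun t ht ↦ ?_⟩
  · let l : Plane → Plane := fun z ↦ mfderiv (𝓡 2) 𝓘(ℝ, Plane) e (e.symm z) (V (e.symm z))
    have hes : ContMDiffOn (𝓡 2) 𝓘(ℝ, Plane) ∞ e (O ∩ e.source) := by
      refine (contMDiffOn_extChartAt (I := 𝓡 2) (n := ∞) (x := q)).mono ?_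
      rw [he, extChartAt_source]
      exact inter_subset_right
    have hO' : IsOpen (O ∩ e.source) := hO.inter (isOpen_extChartAt_source q)
    have hl : ContDiffOn ℝ ∞ l (e.target ∩ e.symm ⁻¹' (O ∩ e.source)) :=
      ((contMDiffOn_mfderiv_section hO' hes (hV.mono inter_subset_left)).comp
        ((contMDiffOn_extChartAt_symm (n := ∞) q).mono inter_subset_left)
        fun z hz ↦ hz.2).contDiffOn
    have hu : ContDiffOn ℝ ∞ (fun t ↦ e (c t)) (Metric.ball t₀ r) := by
      refine contDiffOn_of_hasDerivAt_comp Metric.isOpen_ball hl (fun t ht ↦ ?_) fun t ht ↦ ?_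
      · have hct := (hball t ht).1
        have hd : MDifferentiableAt (𝓡 2) 𝓘(ℝ, Plane) e (c t) :=
          (hes.contMDiffAt (hO'.mem_nhds hct)).mdifferentiableAt (by simp)
        let A : Plane →L[ℝ] Plane := mfderiv (𝓡 2) 𝓘(ℝ, Plane) e (c t)
        let w : Plane := V (c t)
        have h2 : HasFDerivAt (fun t ↦ e (c t)) (A.comp ((1 : ℝ →L[ℝ] ℝ).smulRight w)) t :=
          (HasMFDerivAt.comp t hd.hasMFDerivAt (hball t ht).2).hasFDerivAt
        have key : ∀ p, p = c t → (mfderiv (𝓡 2) 𝓘(ℝ, Plane) e p (V p) : Plane) = A w := by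
          rintro _ rfl
          rfl
        have h3 : l (e (c t)) = A w := key _ (e.left_inv hct.2)
        rw [h3]
        simpa using h2.hasDerivAt
      · have hct := (hball t ht).1
        refine ⟨e.map_source hct.2, ?_⟩
        rwa [mem_preimage, e.left_inv hct.2]
    refine ((contMDiffOn_extChartAt_symm (n := ∞) q).comp hu.contMDiffOn
      fun t ht ↦ e.map_source (hball t ht).1.2).congr fun t ht ↦ ?_
    exact (e.left_inv (hball t ht).1.2).symm
  · unfold velocity
    rw [(hball t ht).2.mfderiv]
    exact one_smul ℝ (V (c t) : Plane)

section

variable {g : LorentzianMetric X} {K : ∀ p : X, TangentSpace (𝓡 2) p} {φ : ℝ → X → X}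
  {x : X → ℝ} {σ : ℝ} {c : ℝ → X}

theorem IsKillingFlow.contMDiff_field (h : IsKillingFlow g K φ) :
    ContMDiff (𝓡 2) (𝓡 2).tangent ∞ (fun p ↦ (⟨p, K p⟩ : TangentBundle (𝓡 2) X)) := by
  intro q
  set e := extChartAt (𝓡 2) q with he
  let H : ℝ × Plane → X := fun z ↦ φ z.1 (e.symm z.2)
  have hO : IsOpen ((univ : Set ℝ) ×ˢ e.target) := isOpen_univ.prod (isOpen_extChartAt_target q)
  have hH : ContMDiffOn 𝓘(ℝ, ℝ × Plane) (𝓡 2) ∞ H (univ ×ˢ e.target) := by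
    have h1 : ContMDiffOn 𝓘(ℝ, ℝ × Plane) 𝓘(ℝ, ℝ) ∞ (fun q : ℝ × Plane ↦ q.1)
        (univ ×ˢ e.target) := contDiff_fst.contMDiff.contMDiffOn
    have h2 : ContMDiffOn 𝓘(ℝ, ℝ × Plane) 𝓘(ℝ, Plane) ∞ (fun q : ℝ × Plane ↦ q.2)
        (univ ×ˢ e.target) := contDiff_snd.contMDiff.contMDiffOn
    exact h.contMDiff.comp_contMDiffOn (h1.prodMk
      ((contMDiffOn_extChartAt_symm (n := ∞) q).comp h2 fun z hz ↦ hz.2))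
  have h1 := contMDiffOn_mfderiv_const hO hH (1, 0)
  have h2 : ContMDiffAt (𝓡 2) 𝓘(ℝ, ℝ × Plane) ∞ (fun p ↦ ((0 : ℝ), e p)) q :=
    (contMDiffAt_const (c := (0 : ℝ))).prodMk_space (contMDiffAt_extChartAt (n := ∞))
  have h3 := ContMDiffAt.comp q
    (h1.contMDiffAt (hO.mem_nhds ⟨mem_univ (0 : ℝ), mem_extChartAt_target q⟩)) h2
  refine h3.congr_of_eventuallyEq ?_
  filter_upwards [extChartAt_source_mem_nhds (I := 𝓡 2) q] with p hp
  have hp' : (0, e p) ∈ (univ : Set ℝ) ×ˢ e.target := ⟨mem_univ _, e.map_source hp⟩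
  have hd : MDifferentiableAt 𝓘(ℝ, ℝ × Plane) (𝓡 2) H (0, e p) :=
    (hH.contMDiffAt (hO.mem_nhds hp')).mdifferentiableAt (by simp)
  have l : HasFDerivAt (fun s : ℝ ↦ (s, e p)) (ContinuousLinearMap.inl ℝ ℝ Plane) 0 :=
    hasFDerivAt_prodMk_left 0 (e p)
  have e1 := (HasMFDerivAt.comp (0 : ℝ) (g := H) hd.hasMFDerivAt l.hasMFDerivAt).mfderiv
  have e2 : (mfderiv 𝓘(ℝ, ℝ × Plane) (𝓡 2) H (0, e p) (1, 0) : Plane) = K (φ 0 (e.symm (e p))) :=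
    (congrArg (fun B : ℝ →L[ℝ] Plane ↦ B 1) e1.symm).trans (h.velocity_flow (e.symm (e p)) 0)
  have e3 : φ 0 (e.symm (e p)) = p := by rw [h.map_zero, e.left_inv hp]
  have key : ∀ (p₁ : X) (v : Plane), p₁ = p → v = K p₁ →
      (⟨p, K p⟩ : TangentBundle (𝓡 2) X) = ⟨p₁, v⟩ := by
    rintro p₁ v rfl rfl
    rfl
  exact key _ _ e3 e2

/-- An indefinite form on the plane does not vanish on a pair of independent vectors one of which is
null. -/
theorem bilin_ne_zero_of_null {B : Plane →L[ℝ] Plane →L[ℝ] ℝ} (hB : ∀ v w, B v w = B w v)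
    (hneg : ∃ u, B u u < 0) (hpos : ∃ u, 0 < B u u) {v w : Plane} (hv : B v v = 0)
    (hvw : LinearIndependent ℝ ![v, w]) : B w v ≠ 0 := by
  intro h0
  have hspan : Submodule.span ℝ (range ![v, w]) = ⊤ :=
    hvw.span_eq_top_of_card_eq_finrank (by simp)
  have hall : ∀ u : Plane, ∃ b : ℝ, B u u = b ^ 2 * B w w := by
    intro u
    have hu : u ∈ Submodule.span ℝ (range ![v, w]) := hspan ▸ Submodule.mem_top
    rw [Matrix.range_cons, Matrix.range_cons, Matrix.range_empty, union_empty,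
      singleton_union, Submodule.mem_span_pair] at hu
    obtain ⟨a, b, rfl⟩ := hu
    refine ⟨b, ?_⟩
    rw [bilin_apply_add_smul B (hB w v) (a, b) (a, b), hB v w, h0, hv]
    ring
  obtain ⟨u₁, h₁⟩ := hneg
  obtain ⟨u₂, h₂⟩ := hpos
  obtain ⟨b₁, hb₁⟩ := hall u₁
  obtain ⟨b₂, hb₂⟩ := hall u₂
  rw [hb₁] at h₁
  rw [hb₂] at h₂
  rcases lt_or_ge (B w w) 0 with h | h
  · nlinarith [sq_nonneg b₂]
  · nlinarith [sq_nonneg b₁]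

/-- Through each point of a ribbon there is a complete null transversal, with the same sign `σ`
for all points. -/
theorem IsRibbon.exists_isNullTransversalOn [T2Space X] {R : Set X} (hR : IsRibbon g K R)
    (h : IsKillingFlow g K φ) (hx : IsTransverseCoordinate g K x) (hg : IsNullComplete g) :
    ∃ σ : ℝ, σ ^ 2 = 1 ∧ ∀ q ∈ R, ∃ c, IsNullTransversalOn g K x σ c univ ∧ c (x q) = q := by
  obtain ⟨L₀, hL₀, hL⟩ := hR.transverse
  have hdx : ContMDiffOn (𝓡 2) 𝓘(ℝ, ℝ) ∞ (fun p ↦ coordDeriv x p (L₀ p)) R :=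
    contMDiffOn_mfderiv_section hR.isOpen hx.1.contMDiffOn hL₀
  have hsq : ∀ p ∈ R, coordDeriv x p (L₀ p) ^ 2 = g.val p (K p) (L₀ p) ^ 2 := fun p hp ↦ by
    rw [hx.coordDeriv_sq, (hL p hp).1, mul_zero, sub_zero]
  have hdx0 : ∀ p ∈ R, coordDeriv x p (L₀ p) ≠ 0 := fun p hp h0 ↦ by
    have h1 := hsq p hp
    rw [h0] at h1
    have h2 : g.val p (K p) (L₀ p) = 0 := pow_eq_zero_iff two_ne_zero |>.1 (by rw [← h1]; ring)
    exact bilin_ne_zero_of_null (g.symm p) (g.exists_neg p) (g.exists_pos p) (hL p hp).1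
      (hL p hp).2 h2
  -- the null field, normalized by `dx(L) = 1`
  let L : ∀ p : X, TangentSpace (𝓡 2) p := fun p ↦ (coordDeriv x p (L₀ p))⁻¹ • L₀ p
  have hLs : ContMDiffOn (𝓡 2) (𝓡 2).tangent ∞ (fun p ↦ (⟨p, L p⟩ : TangentBundle (𝓡 2) X)) R :=
    ContMDiffOn.smul_section (hdx.inv₀ hdx0) hL₀
  have hL1 : ∀ p ∈ R, coordDeriv x p (L p) = 1 := fun p hp ↦ by
    simp only [L, map_smul, smul_eq_mul]
    exact inv_mul_cancel₀ (hdx0 p hp)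
  have hLn : ∀ p ∈ R, g.val p (L p) (L p) = 0 := fun p hp ↦ by
    simp [L, (hL p hp).1]
  have hLsq : ∀ p ∈ R, g.val p (L p) (K p) ^ 2 = 1 := fun p hp ↦ by
    have := hx.coordDeriv_sq p (L p)
    rw [hL1 p hp, hLn p hp, g.symm] at this
    linarith
  have hcont : ContinuousOn (fun p ↦ g.val p (L p) (K p)) R := by
    have h4 := ContMDiffOn.clm_bundle_apply₂ (F₃ := ℝ) (E₃ := Bundle.Trivial X ℝ)
      g.contMDiff.contMDiffOn hLs h.contMDiff_field.contMDiffOn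
    intro q hq
    have := h4 q hq
    rw [Bundle.contMDiffWithinAt_totalSpace] at this
    exact this.2.continuousWithinAt
  have hRp := hR.isSimplyConnected.isPathConnected
  obtain ⟨q₀, hq₀⟩ := hRp.nonempty
  refine ⟨g.val q₀ (L q₀) (K q₀), hLsq _ hq₀, fun q hq ↦ ?_⟩
  have hσ : ∀ p ∈ R, g.val p (L p) (K p) = g.val q₀ (L q₀) (K q₀) := fun p hp ↦
    hRp.isConnected.isPreconnected.eq_of_sq_eq
      (g := fun _ ↦ g.val q₀ (L q₀) (K q₀)) hcont continuousOn_const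
      (fun p hp ↦ (hLsq p hp).trans (hLsq _ hq₀).symm)
      (fun _ h0 ↦ by have := hLsq _ hq₀; rw [h0] at this; simp at this) hq₀ rfl hp
  obtain ⟨c, r, hr, hc0, hcR, hcs, hcv⟩ := exists_contMDiffOn_integralCurve hR.isOpen hLs hq (x q)
  have hball := Metric.mem_ball_self (x := x q) hr
  have hc : IsNullTransversalOn g K x (g.val q₀ (L q₀) (K q₀)) c (Metric.ball (x q) r) := by
    refine ⟨hcs, fun s hs ↦ ?_, fun s hs ↦ ?_, fun s hs ↦ ?_⟩
    · rw [normSqVelocity, hcv s hs, hLn _ (hcR hs)]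
    · rw [momentum, hcv s hs, hσ _ (hcR hs)]
    · have hd : ∀ s ∈ Metric.ball (x q) r, HasDerivAt (fun s ↦ x (c s) - s) (1 - 1) s := by
        intro s hs
        have h1 := hasDerivAt_comp_curve (hx.mdifferentiableAt (c s))
          ((hcs.contMDiffAt (Metric.isOpen_ball.mem_nhds hs)).mdifferentiableAt (by simp))
        rw [hcv s hs, hL1 _ (hcR hs)] at h1
        exact h1.sub (hasDerivAt_id s)
      have h2 : x (c s) - s = x (c (x q)) - x q := Metric.isOpen_ball.is_const_of_deriv_eq_zero
        (convex_ball _ _).isPreconnected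
        (fun s hs ↦ (hd s hs).differentiableAt.differentiableWithinAt)
        (fun s hs ↦ (hd s hs).deriv.trans (sub_self 1)) hs hball
      rw [hc0] at h2
      linarith
  obtain ⟨c', hc', heq⟩ := hc.exists_extension (hLsq _ hq₀) h hx hg Metric.isOpen_ball
    (convex_ball _ _).ordConnected ⟨x q, hball⟩
  exact ⟨c', hc', by rw [← heq hball, hc0]⟩

end
end Surface

/-! ### Maximal ribbons are swept out by a null transversal -/

section Surface

variable {X : Type*} [TopologicalSpace X] [ChartedSpace Plane X] [IsManifold (𝓡 2) ∞ X]
  {g : LorentzianMetric X} {K : ∀ p : X, TangentSpace (𝓡 2) p} {φ : ℝ → X → X}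
  {x : X → ℝ} {σ : ℝ} {c : ℝ → X}

theorem IsNullTransversalOn.field_ne_zero (hc : IsNullTransversalOn g K x σ c univ)
    (hσ : σ ^ 2 = 1) (s : ℝ) : K (c s) ≠ 0 := by
  intro h0
  have h1 := hc.momentum_eq s (mem_univ s)
  rw [momentum, h0, map_zero] at h1
  rw [← h1] at hσ
  simp at hσ

/-- The periods of the orbit of `p`. -/
def IsKillingFlow.stabilizer (h : IsKillingFlow g K φ) (p : X) : AddSubgroup ℝ where
  carrier := {t | φ t p = p}
  zero_mem' := h.map_zero p
  add_mem' := fun {a b} ha hb ↦ by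
    rw [mem_ofPred_eq] at ha hb ⊢
    rw [h.map_add, hb, ha]
  neg_mem' := fun {a} ha ↦ by
    rw [mem_ofPred_eq] at ha ⊢
    conv_lhs => rw [← ha]
    rw [← h.map_add, neg_add_cancel, h.map_zero]

theorem IsKillingFlow.mem_stabilizer (h : IsKillingFlow g K φ) {p : X} {t : ℝ} :
    t ∈ h.stabilizer p ↔ φ t p = p := Iff.rfl

theorem exists_eq_zmultiples {Λ : AddSubgroup ℝ} (hΛ : IsClosed (Λ : Set ℝ)) (htop : Λ ≠ ⊤) :
    ∃ T, Λ = AddSubgroup.zmultiples T := by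
  rcases Λ.dense_or_cyclic with hd | ⟨T, hT⟩
  · refine absurd ?_ htop
    rw [← AddSubgroup.coe_eq_univ, ← hΛ.closure_eq, hd.closure_eq]
  · exact ⟨T, by rw [hT, AddSubgroup.zmultiples_eq_closure]⟩

/-- The periods of the orbits which meet a null transversal are the multiples of one number. -/
theorem IsNullTransversalOn.exists_period [T2Space X] (hc : IsNullTransversalOn g K x σ c univ)
    (hσ : σ ^ 2 = 1) (h : IsKillingFlow g K φ) (hx : IsTransverseCoordinate g K x) :
    ∃ T₀ : ℝ, ∀ s t, φ t (c s) = c s ↔ t ∈ AddSubgroup.zmultiples T₀ := by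
  have hstep : ∀ s s' t, φ t (c s) = c s → φ t (c s') = c s' := fun s s' t ht ↦
    congrFun ((hc.flow_comp h hx t).eq_of_apply_eq hc hσ h hx ht) s'
  have hcl : IsClosed (h.stabilizer (c 0) : Set ℝ) :=
    isClosed_eq (h.contMDiff.continuous.comp (Continuous.prodMk_left (c 0))) continuous_const
  -- the orbits are not constant, since `K` does not vanish on the transversal
  have htop : h.stabilizer (c 0) ≠ ⊤ := by
    intro htop
    have hconst : (fun t ↦ φ t (c 0)) = fun _ ↦ c 0 := by
      funext t
      exact h.mem_stabilizer.1 (htop ▸ AddSubgroup.mem_top t)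
    have hv : (velocity (fun t ↦ φ t (c 0)) 0 : Plane) = 0 := by
      unfold velocity
      rw [hconst, mfderiv_const]
      rfl
    have hK : (K (φ 0 (c 0)) : Plane) = 0 := (h.velocity_flow (c 0) 0).symm.trans hv
    rw [h.map_zero] at hK
    exact hc.field_ne_zero hσ 0 hK
  obtain ⟨T₀, hT₀⟩ := exists_eq_zmultiples hcl htop
  refine ⟨T₀, fun s t ↦ ?_⟩
  rw [← hT₀, h.mem_stabilizer]
  exact ⟨hstep s 0 t, hstep 0 s t⟩

/-- If the orbits which meet a null transversal were periodic, they would sweep out a closed set,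
since the transverse coordinate would be proper on that cylinder. -/
theorem IsNullTransversalOn.surjective_flowMap [T2Space X] [ConnectedSpace X]
    (hc : IsNullTransversalOn g K x σ c univ) (hσ : σ ^ 2 = 1) (h : IsKillingFlow g K φ)
    (hx : IsTransverseCoordinate g K x) {T₀ : ℝ} (hT₀ : T₀ ≠ 0) (hper : ∀ s, φ T₀ (c s) = c s) :
    Function.Surjective (flowMap φ c) := by
  have hperz : ∀ (s : ℝ) (n : ℤ), φ (n • T₀) (c s) = c s := fun s n ↦
    h.mem_stabilizer.1 (AddSubgroup.zsmul_mem _ (h.mem_stabilizer.2 (hper s)) n)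
  have hΦc : Continuous (flowMap φ c) := (hc.contMDiff_flowMap h).continuous
  have hopen : IsOpenMap (flowMap φ c) := hc.isOpenMap_flowMap hσ h
  rw [← range_eq_univ]
  refine IsClopen.eq_univ ⟨?_, hopen.isOpen_range⟩ (range_nonempty _)
  refine isClosed_of_closure_subset fun q hq ↦ ?_
  -- near `q` the range lies in the image of a compact set, which is closed
  have hcomp : IsClosed (flowMap φ c '' (Icc (x q - 1) (x q + 1) ×ˢ Icc 0 |T₀|)) :=
    ((isCompact_Icc.prod isCompact_Icc).image hΦc).isClosed
  have hU : IsOpen {p | x p ∈ Ioo (x q - 1) (x q + 1)} :=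
    isOpen_Ioo.preimage hx.1.continuous
  have hqU : q ∈ {p | x p ∈ Ioo (x q - 1) (x q + 1)} := by simp
  have hsub : range (flowMap φ c) ∩ {p | x p ∈ Ioo (x q - 1) (x q + 1)}
      ⊆ flowMap φ c '' (Icc (x q - 1) (x q + 1) ×ˢ Icc 0 |T₀|) := by
    rintro _ ⟨⟨⟨s, t⟩, rfl⟩, hp⟩
    rw [mem_ofPred_eq, hc.coord_flowMap h hx] at hp
    have habs : 0 < |T₀| := abs_pos.2 hT₀
    obtain ⟨n, hn⟩ : ∃ n : ℤ, toIcoDiv habs 0 t • |T₀| = n • T₀ := by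
      rcases abs_choice T₀ with h1 | h1
      · exact ⟨toIcoDiv habs 0 t, by simp only [h1]⟩
      · exact ⟨-toIcoDiv habs 0 t, by rw [neg_smul, ← smul_neg, ← h1]⟩
    have h1 := toIcoMod_add_toIcoDiv_zsmul habs 0 t
    have h2 := toIcoMod_mem_Ico habs 0 t
    rw [zero_add] at h2
    refine ⟨(s, toIcoMod habs 0 t), ⟨Ioo_subset_Icc_self hp, Ico_subset_Icc_self h2⟩, ?_⟩
    simp only [flowMap]
    conv_rhs => rw [← h1, hn, h.map_add, hperz]
  have hq' : q ∈ closure (range (flowMap φ c) ∩ {p | x p ∈ Ioo (x q - 1) (x q + 1)}) := by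
    rw [inter_comm]
    exact hU.inter_closure ⟨hqU, hq⟩
  exact (image_subset_range _ _) (hcomp.closure_subset_iff.2 hsub hq')

theorem IsNullTransversalOn.fst_eq (hc : IsNullTransversalOn g K x σ c univ)
    (h : IsKillingFlow g K φ) (hx : IsTransverseCoordinate g K x) {q q' : ℝ × ℝ}
    (hqq : flowMap φ c q = flowMap φ c q') : q.1 = q'.1 := by
  have := congrArg x hqq
  rwa [hc.coord_flowMap h hx, hc.coord_flowMap h hx] at this

theorem IsNullTransversalOn.flow_sub_eq (hc : IsNullTransversalOn g K x σ c univ)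
    (h : IsKillingFlow g K φ) (hx : IsTransverseCoordinate g K x) {q q' : ℝ × ℝ}
    (hqq : flowMap φ c q = flowMap φ c q') : φ (q.2 - q'.2) (c q.1) = c q.1 := by
  have h1 := hc.fst_eq h hx hqq
  have h2 : φ q.2 (c q.1) = φ q'.2 (c q.1) := by
    rw [flowMap, flowMap, ← h1] at hqq
    exact hqq
  rw [sub_eq_neg_add, h.map_add, h2, ← h.map_add, neg_add_cancel, h.map_zero]

/-- If an orbit which meets a null transversal were periodic, then `X` would be the product of a
line and a circle, in contradiction with simple connectedness: the flow parameter would be a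
continuous function to the circle, whose lift to the line increases by a period along the orbit. -/
theorem IsNullTransversalOn.injective_flowMap [T2Space X] [SimplyConnectedSpace X]
    (hc : IsNullTransversalOn g K x σ c univ) (hσ : σ ^ 2 = 1) (h : IsKillingFlow g K φ)
    (hx : IsTransverseCoordinate g K x) : Function.Injective (flowMap φ c) := by
  obtain ⟨T₀, hT₀⟩ := hc.exists_period hσ h hx
  rcases eq_or_ne T₀ 0 with rfl | hT₀0
  · intro q q' hqq
    have h1 := (hT₀ _ _).1 (hc.flow_sub_eq h hx hqq)
    rw [AddSubgroup.zmultiples_zero_eq_bot, AddSubgroup.mem_bot, sub_eq_zero] at h1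
    exact Prod.ext (hc.fst_eq h hx hqq) h1
  exfalso
  have hper : ∀ s, φ T₀ (c s) = c s := fun s ↦
    (hT₀ s T₀).2 (AddSubgroup.mem_zmultiples T₀)
  have hfac : ∀ q q' : ℝ × ℝ, flowMap φ c q = flowMap φ c q' →
      (q.2 : AddCircle T₀) = (q'.2 : AddCircle T₀) := fun q q' hqq ↦
    QuotientAddGroup.eq_iff_sub_mem.2 ((hT₀ _ _).1 (hc.flow_sub_eq h hx hqq))
  have hΦc : Continuous (flowMap φ c) := (hc.contMDiff_flowMap h).continuous
  have hquot : Topology.IsQuotientMap (flowMap φ c) :=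
    (hc.isOpenMap_flowMap hσ h).isQuotientMap hΦc (hc.surjective_flowMap hσ h hx hT₀0 hper)
  let τ : C(ℝ × ℝ, AddCircle T₀) :=
    ⟨fun q : ℝ × ℝ ↦ (q.2 : AddCircle T₀), (AddCircle.continuous_mk' T₀).comp continuous_snd⟩
  let Φ : C(ℝ × ℝ, X) := ⟨flowMap φ c, hΦc⟩
  have hquot' : Topology.IsQuotientMap Φ := hquot
  let θ : C(X, AddCircle T₀) := hquot'.lift τ fun q q' hqq ↦ hfac q q' hqq
  have hθ : ∀ q, θ (flowMap φ c q) = (q.2 : AddCircle T₀) := fun q ↦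
    DFunLike.congr_fun (hquot'.lift_comp τ fun q q' hqq ↦ hfac q q' hqq) q
  have hθ0 : ((0 : ℝ) : AddCircle T₀) = θ (c 0) := by
    have := hθ (0, 0)
    rw [flowMap, h.map_zero] at this
    exact this.symm
  have : LocallyPathConnectedSpace X := ChartedSpace.locallyPathConnectedSpace Plane X
  obtain ⟨F, ⟨hF0, hF⟩, -⟩ := (AddCircle.isCoveringMap_coe T₀).existsUnique_continuousMap_lifts θ
    (c 0) 0 hθ0
  have hline : (fun t ↦ F (φ t (c 0))) = id := by
    refine (AddCircle.isCoveringMap_coe T₀).eq_of_comp_eq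
      (F.continuous.comp (h.contMDiff.continuous.comp (Continuous.prodMk_left (c 0))))
      continuous_id (funext fun t ↦ ?_) 0 ?_
    · exact (congrFun hF (φ t (c 0))).trans (hθ (0, t))
    · simp only [h.map_zero, hF0, id]
  -- the orbit is closed, but the lift is the identity along it
  have h1 := congrFun hline T₀
  simp only [hper, hF0, id] at h1
  exact hT₀0 h1.symm

/-- The set swept out by a complete null transversal is a ribbon. -/
theorem IsNullTransversalOn.isRibbon_range [T2Space X] [SimplyConnectedSpace X]
    (hc : IsNullTransversalOn g K x σ c univ) (hσ : σ ^ 2 = 1) (h : IsKillingFlow g K φ)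
    (hx : IsTransverseCoordinate g K x) : IsRibbon g K (range (flowMap φ c)) := by
  have hσ0 : σ ≠ 0 := by rintro rfl; simp at hσ
  have hinj := hc.injective_flowMap hσ h hx
  have hΦ := hc.contMDiff_flowMap h
  have hopen := hc.isOpenMap_flowMap hσ h
  have hemb : Topology.IsOpenEmbedding (flowMap φ c) :=
    .of_continuous_injective_isOpenMap hΦ.continuous hinj hopen
  refine ⟨hopen.isOpen_range, ?_, ?_, ?_, ?_⟩
  · have : SimplyConnectedSpace (ℝ × ℝ) := inferInstance
    exact hemb.isEmbedding.toHomeomorph.toHomotopyEquiv.simplyConnectedSpace_iff.1 this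
  · rintro γ hγ ⟨q, hq⟩ t
    have h1 : γ = fun t ↦ φ t (γ 0) :=
      isMIntegralCurve_Ioo_eq_of_contMDiff_boundaryless (t₀ := 0)
        (h.contMDiff_field.of_le (by norm_cast)) hγ (h.isMIntegralCurve (γ 0))
        (h.map_zero _).symm
    rw [h1]
    refine ⟨(q.1, t + q.2), ?_⟩
    simp only [flowMap, h.map_add]
    rw [← hq, flowMap]
  · rintro _ ⟨q, rfl⟩
    exact (hc.flow_comp h hx q.2).field_ne_zero hσ q.1
  · let Ψ : X → ℝ × ℝ := Function.invFun (flowMap φ c)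
    have hΨ : ∀ q, Ψ (flowMap φ c q) = q := Function.leftInverse_invFun hinj
    refine ⟨fun p ↦ (mfderiv 𝓘(ℝ, ℝ × ℝ) (𝓡 2) (flowMap φ c) (Ψ p) (1, 0) : Plane), ?_, ?_⟩
    · rintro _ ⟨q, rfl⟩
      obtain ⟨Ψ', h1, h2, h3⟩ := hc.exists_rightInverse hσ h q
      have h4 := contMDiffOn_univ.1
        (contMDiffOn_mfderiv_const isOpen_univ hΦ.contMDiffOn ((1, 0) : ℝ × ℝ))
      have h5 := ContMDiffAt.comp (flowMap φ c q) (h4 (Ψ' (flowMap φ c q))) h1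
      refine (h5.congr_of_eventuallyEq ?_).contMDiffWithinAt
      filter_upwards [h3] with p hp
      have h6 : Ψ p = Ψ' p := by
        conv_lhs => rw [← hp]
        exact hΨ _
      have key : ∀ (p₁ : X) (v w : Plane), p₁ = p → v = w →
          (⟨p, v⟩ : TangentBundle (𝓡 2) X) = ⟨p₁, w⟩ := by
        rintro p₁ v w rfl rfl
        rfl
      exact key _ _ _ hp (congrArg
        (fun q ↦ (mfderiv 𝓘(ℝ, ℝ × ℝ) (𝓡 2) (flowMap φ c) q (1, 0) : Plane)) h6)
    · rintro _ ⟨q, rfl⟩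
      let A : ℝ × ℝ →L[ℝ] Plane := mfderiv 𝓘(ℝ, ℝ × ℝ) (𝓡 2) (flowMap φ c) q
      have key : ∀ v : Plane, v = A (1, 0) → g.val (flowMap φ c q) v v = 0 ∧
          LinearIndependent ℝ ![v, (K (flowMap φ c q) : Plane)] := by
        rintro _ rfl
        constructor
        · have : pullMetric g (flowMap φ c) q (1, 0) (1, 0) = 0 := by
            rw [hc.pullMetric_flowMap h isOpen_univ (mem_univ q.1)]
            simp
          exact this
        · have hA : Function.Injective A :=
            (hc.mfderiv_flowMap_bijective hσ0 h isOpen_univ (mem_univ q.1)).1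
          have hK : A (0, 1) = K (flowMap φ c q) := by
            refine (h.mfderiv_flowMap isOpen_univ hc.contMDiffOn (mem_univ q.1) (0, 1)).trans ?_
            simp [flowMap]
          rw [← hK, LinearIndependent.pair_iff]
          intro a b hab
          rw [← map_smul, ← map_smul, ← map_add] at hab
          simpa using hA (hab.trans (map_zero A).symm)
      exact key _ (congrArg
        (fun q ↦ (mfderiv 𝓘(ℝ, ℝ × ℝ) (𝓡 2) (flowMap φ c) q (1, 0) : Plane)) (hΨ q))

/-- A ribbon is contained in the set swept out by a null transversal through one of its points: the
sets swept out by two transversals are equal or disjoint. -/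
theorem IsRibbon.exists_subset_range [T2Space X] {R : Set X} (hR : IsRibbon g K R)
    (h : IsKillingFlow g K φ) (hx : IsTransverseCoordinate g K x) (hg : IsNullComplete g) :
    ∃ σ c, σ ^ 2 = 1 ∧ IsNullTransversalOn g K x σ c univ ∧ R ⊆ range (flowMap φ c) := by
  obtain ⟨σ, hσ, hall⟩ := hR.exists_isNullTransversalOn h hx hg
  choose! C hC hCq using hall
  have hRp := hR.isSimplyConnected.isPathConnected
  obtain ⟨q₀, hq₀⟩ := hRp.nonempty
  have hself : ∀ q ∈ R, q ∈ range (flowMap φ (C q)) := fun q hq ↦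
    ⟨(x q, 0), by rw [flowMap, h.map_zero, hCq q hq]⟩
  have hopen : ∀ q ∈ R, IsOpen (range (flowMap φ (C q))) := fun q hq ↦
    ((hC q hq).isOpenMap_flowMap hσ h).isOpen_range
  refine ⟨σ, C q₀, hσ, hC q₀ hq₀, ?_⟩
  refine hRp.isConnected.isPreconnected.subset_left_of_subset_union
    (v := ⋃ q ∈ {q ∈ R | Disjoint (range (flowMap φ (C q₀))) (range (flowMap φ (C q)))},
      range (flowMap φ (C q))) (hopen q₀ hq₀) (isOpen_biUnion fun q hq ↦ hopen q hq.1)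
    (disjoint_iUnion₂_right.2 fun q hq ↦ hq.2) (fun q hq ↦ ?_) ⟨q₀, hq₀, hself q₀ hq₀⟩
  by_cases hd : Disjoint (range (flowMap φ (C q₀))) (range (flowMap φ (C q)))
  · exact .inr (mem_biUnion (show q ∈ {q ∈ R | _} from ⟨hq, hd⟩) (hself q hq))
  left
  rw [not_disjoint_iff] at hd
  obtain ⟨_, ⟨⟨s, t⟩, rfl⟩, ⟨s', t'⟩, hst⟩ := hd
  have hs : s' = s := by
    have := congrArg x hst
    rwa [(hC q hq).coord_flowMap h hx, (hC q₀ hq₀).coord_flowMap h hx] at this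
  subst hs
  have h1 : φ (-t' + t) (C q₀ s') = C q s' := by
    simp only [flowMap] at hst
    rw [h.map_add, ← hst, ← h.map_add, neg_add_cancel, h.map_zero]
  have h2 := congrFun (((hC q₀ hq₀).flow_comp h hx (-t' + t)).eq_of_apply_eq (hC q hq) hσ h hx h1)
    (x q)
  rw [hCq q hq] at h2
  exact ⟨(x q, -t' + t), h2⟩

theorem IsMaximalRibbon.exists_eq_range [T2Space X] [SimplyConnectedSpace X] {R : Set X}
    (hR : IsMaximalRibbon g K R) (h : IsKillingFlow g K φ) (hx : IsTransverseCoordinate g K x)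
    (hg : IsNullComplete g) :
    ∃ σ c, σ ^ 2 = 1 ∧ IsNullTransversalOn g K x σ c univ ∧ R = range (flowMap φ c) := by
  obtain ⟨σ, c, hσ, hc, hsub⟩ := hR.prop.exists_subset_range h hx hg
  exact ⟨σ, c, hσ, hc, hR.eq_of_subset (hc.isRibbon_range hσ h hx) hsub⟩

end Surface

/-! ### Travel times of a particle in a potential -/

section Analysis

/-- A motion `u` with `u'² = D + E h(u)` which goes to infinity in finite time has finite integral
`∫ dy / √(D + E h(y))`. The radicand is increased by `1`, so that turning points need no care. -/
theorem integrableOn_of_bddAbove {h u w : ℝ → ℝ} {J : Set ℝ} {t₀ D E : ℝ} (hh : Continuous h)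
    (hJ : J.OrdConnected) (ht₀ : t₀ ∈ J) (hu : ∀ t ∈ J, HasDerivAt u (w t) t)
    (hw : ∀ t ∈ J, w t ^ 2 = D + E * h (u t)) (hunb : ¬ BddAbove (u '' (J ∩ Ici t₀)))
    (hb : BddAbove J) :
    IntegrableOn (fun y ↦ 1 / √(|D + E * h y| + 1)) (Ioi (u t₀)) ∧
      ∀ y ∈ Ioi (u t₀), 0 ≤ D + E * h y := by
  constructor
  swap
  · intro y hy
    obtain ⟨_, ⟨t, ⟨ht, htt⟩, rfl⟩, hyt⟩ := not_bddAbove_iff.1 hunb y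
    have hsub : Icc t₀ t ⊆ J := hJ.out ht₀ ht
    obtain ⟨s, hs, rfl⟩ := intermediate_value_Icc htt
      (fun s hs ↦ (hu s (hsub hs)).continuousAt.continuousWithinAt) ⟨(mem_Ioi.1 hy).le, hyt.le⟩
    rw [← hw s (hsub hs)]
    exact sq_nonneg _
  set ρ : ℝ → ℝ := fun y ↦ 1 / √(|D + E * h y| + 1) with hρ
  have hpos : ∀ y, 0 < √(|D + E * h y| + 1) := fun y ↦ Real.sqrt_pos.2 (by positivity)
  have hρc : Continuous ρ := by
    refine continuous_const.div ?_ fun y ↦ (hpos y).ne'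
    fun_prop
  have hρ0 : ∀ y, 0 ≤ ρ y := fun y ↦ (one_div_pos.2 (hpos y)).le
  obtain ⟨b, hb⟩ := hb
  let F : ℝ → ℝ := fun y ↦ ∫ z in (u t₀)..y, ρ z
  have hF : ∀ y, HasDerivAt F (ρ y) y := fun y ↦
    intervalIntegral.integral_hasDerivAt_right (hρc.intervalIntegrable _ _)
      (hρc.stronglyMeasurableAtFilter _ _) hρc.continuousAt
  -- time elapses at least as fast as `F` increases along the motion
  have hbound : ∀ t ∈ J, t₀ ≤ t → F (u t) ≤ b - t₀ := by
    intro t ht htt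
    have h1 := hJ.convex.norm_image_sub_le_of_norm_hasDerivWithin_le (C := 1)
      (f := fun t ↦ F (u t)) (f' := fun t ↦ ρ (u t) * w t) (x := t₀) (y := t)
      (fun s hs ↦ ((hF (u s)).comp s (hu s hs)).hasDerivWithinAt) (fun s hs ↦ by
        have h2 : |w s| ≤ √(|D + E * h (u s)| + 1) := by
          apply Real.abs_le_sqrt
          rw [hw s hs]
          linarith [le_abs_self (D + E * h (u s))]
        rw [Real.norm_eq_abs, abs_mul, abs_of_nonneg (hρ0 _), hρ, one_div_mul_eq_div]
        exact (div_le_one (hpos _)).2 h2) ht₀ ht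
    have h3 : F (u t₀) = 0 := intervalIntegral.integral_same
    rw [h3, sub_zero, one_mul, Real.norm_eq_abs, Real.norm_eq_abs,
      abs_of_nonneg (sub_nonneg.2 htt)] at h1
    linarith [le_abs_self (F (u t)), hb ht]
  have hFmono : Monotone F := monotone_of_deriv_nonneg (fun y ↦ (hF y).differentiableAt)
    fun y ↦ by rw [(hF y).deriv]; exact hρ0 y
  have hFb : ∀ y, F y ≤ b - t₀ := by
    intro y
    rw [not_bddAbove_iff] at hunb
    obtain ⟨_, ⟨t, ⟨ht, htt⟩, rfl⟩, hyt⟩ := hunb y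
    exact (hFmono hyt.le).trans (hbound t ht htt)
  refine integrableOn_Ioi_of_intervalIntegral_norm_bounded (b := fun y : ℝ ↦ y) (l := atTop)
    (b - t₀) (u t₀)
    (fun y ↦ (hρc.integrableOn_Icc (a := u t₀) (b := y)).mono_set Ioc_subset_Icc_self)
    tendsto_id (.of_forall fun y ↦ ?_)
  have h4 : (fun z ↦ ‖ρ z‖) = ρ := funext fun z ↦ by
    rw [Real.norm_eq_abs, abs_of_nonneg (hρ0 z)]
  simp only [h4]
  exact hFb y

theorem not_conditionCR_of_integrableOn {ε : ℝ} {f : ℝ → ℝ} (hf : Continuous f) {D E y₀ : ℝ}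
    (hE : 0 < E)
    (hint : IntegrableOn (fun y ↦ 1 / √(|D + E * (-ε * f y)| + 1)) (Ioi y₀))
    (hpos : ∀ y ∈ Ioi y₀, 0 ≤ D + E * (-ε * f y)) : ¬ ConditionCR ε f := by
  set h : ℝ → ℝ := fun s ↦ -ε * f s with hh
  have hhc : Continuous h := continuous_const.mul hf
  have hfin : ∫⁻ y in Ioi y₀, ENNReal.ofReal (1 / √(|D + E * h y| + 1)) < ⊤ :=
    hint.lintegral_lt_top
  have hcover : ∀ A : Set ℝ, A ∩ Ici 0 ⊆ (A ∩ Ioi y₀) ∪ (A ∩ Icc 0 y₀) := by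
    rintro A y ⟨hyA, hy⟩
    rcases lt_or_ge y₀ y with h1 | h1
    · exact .inl ⟨hyA, h1⟩
    · exact .inr ⟨hyA, hy, h1⟩
  have hIcc : volume (Icc 0 y₀) < ⊤ := isCompact_Icc.measure_lt_top
  rintro (⟨M, -, hM⟩ | ⟨-, α, hα, hinf⟩)
  · -- the integrand is bounded below by a positive constant on `{h ≤ M}`
    have hmeas : MeasurableSet ({s | h s ≤ M} ∩ Ioi y₀) :=
      (isClosed_le hhc continuous_const).measurableSet.inter measurableSet_Ioi
    set κ := ENNReal.ofReal (1 / √(|D + E * M| + 1)) with hκ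
    have hκ0 : κ ≠ 0 := by
      rw [hκ, Ne, ENNReal.ofReal_eq_zero, not_le]
      positivity
    have h1 : κ * volume ({s | h s ≤ M} ∩ Ioi y₀) < ⊤ := by
      rw [← setLIntegral_const]
      refine lt_of_le_of_lt ?_ hfin
      refine (setLIntegral_mono' hmeas fun y hy ↦ ?_).trans (lintegral_mono_set inter_subset_right)
      refine ENNReal.ofReal_le_ofReal (one_div_le_one_div_of_le ?_ (Real.sqrt_le_sqrt ?_))
      · exact Real.sqrt_pos.2 (by positivity)
      · have h2 : E * h y ≤ E * M := mul_le_mul_of_nonneg_left hy.1 hE.le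
        rw [abs_of_nonneg (hpos y hy.2)]
        linarith [le_abs_self (D + E * M)]
    have h2 : volume ({s | h s ≤ M} ∩ Ioi y₀) < ⊤ := ENNReal.lt_top_of_mul_ne_top_right h1.ne hκ0
    have h3 : volume ({s | h s ≤ M} ∩ Ici 0) < ⊤ :=
      (measure_mono (hcover _)).trans_lt ((measure_union_le _ _).trans_lt
        (ENNReal.add_lt_top.2 ⟨h2, (measure_mono inter_subset_right).trans_lt hIcc⟩))
    exact h3.ne hM
  · -- the integrand is at least a multiple of `1 / √h` on `{α ≤ h}`
    have hclosed : MeasurableSet {s | α ≤ h s} := (isClosed_le continuous_const hhc).measurableSet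
    set q := (|D| + 1) / α + E with hq
    have hq0 : 0 < q := by positivity
    have h1 : ∫⁻ s in {s | α ≤ h s} ∩ Ioi y₀, ENNReal.ofReal (1 / √(h s)) < ⊤ := by
      have h2 : ∫⁻ s in {s | α ≤ h s} ∩ Ioi y₀, ENNReal.ofReal (1 / √(h s))
          ≤ ∫⁻ y in Ioi y₀, ENNReal.ofReal √q * ENNReal.ofReal (1 / √(|D + E * h y| + 1)) := by
        refine (setLIntegral_mono' (hclosed.inter measurableSet_Ioi) fun y hy ↦ ?_).trans
          (lintegral_mono_set inter_subset_right)
        have hy1 : α ≤ h y := hy.1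
        have hy0 : 0 < h y := hα.trans_le hy1
        rw [← ENNReal.ofReal_mul (Real.sqrt_nonneg q)]
        refine ENNReal.ofReal_le_ofReal ?_
        have hs0 : 0 < √(|D + E * h y| + 1) := Real.sqrt_pos.2 (by positivity)
        rw [mul_one_div, div_le_div_iff₀ (Real.sqrt_pos.2 hy0) hs0, one_mul,
          ← Real.sqrt_mul hq0.le]
        refine Real.sqrt_le_sqrt ?_
        have h3 : |D| + 1 ≤ (|D| + 1) / α * h y := by
          rw [div_mul_eq_mul_div, le_div_iff₀ hα]
          exact mul_le_mul_of_nonneg_left hy1 (by positivity)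
        rw [abs_of_nonneg (hpos y hy.2), hq, add_mul]
        linarith [le_abs_self D]
      refine h2.trans_lt ?_
      rw [lintegral_const_mul' _ _ ENNReal.ofReal_ne_top]
      exact ENNReal.mul_lt_top ENNReal.ofReal_lt_top hfin
    have h2 : ∫⁻ s in {s | α ≤ h s} ∩ Icc 0 y₀, ENNReal.ofReal (1 / √(h s)) < ⊤ := by
      have h3 : ∫⁻ s in {s | α ≤ h s} ∩ Icc 0 y₀, ENNReal.ofReal (1 / √(h s))
          ≤ ∫⁻ _ in Icc 0 y₀, ENNReal.ofReal (1 / √α) :=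
        (setLIntegral_mono' (hclosed.inter measurableSet_Icc) fun y hy ↦
          ENNReal.ofReal_le_ofReal (one_div_le_one_div_of_le (Real.sqrt_pos.2 hα)
            (Real.sqrt_le_sqrt hy.1))).trans (lintegral_mono_set inter_subset_right)
      refine h3.trans_lt ?_
      rw [setLIntegral_const]
      exact ENNReal.mul_lt_top ENNReal.ofReal_lt_top hIcc
    have h3 : ∫⁻ s in {s | α ≤ h s} ∩ Ici 0, ENNReal.ofReal (1 / √(h s)) < ⊤ :=
      (lintegral_mono_set (hcover _)).trans_lt ((lintegral_union_le _ _ _).trans_lt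
        (ENNReal.add_lt_top.2 ⟨h1, h2⟩))
    exact h3.ne hinf

/-- If the analytic condition fails, a motion with `u' = v(u)`, where `v² = D + h`, reaches infinity
in finite time. -/
theorem integrableOn_of_not_conditionCR {ε : ℝ} {f : ℝ → ℝ} (hf : Continuous f) {D : ℝ}
    (hD : 0 ≤ D) (hpos : ∀ s, 1 ≤ D + -ε * f s) (hCR : ¬ ConditionCR ε f) :
    IntegrableOn (fun s ↦ 1 / √(D + -ε * f s)) (Ioi 0) := by
  set h : ℝ → ℝ := fun s ↦ -ε * f s with hh
  have hhc : Continuous h := continuous_const.mul hf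
  have hcont : Continuous fun s ↦ 1 / √(D + h s) :=
    continuous_const.div (by fun_prop) fun s ↦
      (Real.sqrt_pos.2 (zero_lt_one.trans_le (hpos s))).ne'
  rw [ConditionCR, not_or, not_and_or] at hCR
  obtain ⟨h1, h2⟩ := hCR
  push Not at h1 h2
  have h1' : volume ({s | h s ≤ 1} ∩ Ici 0) < ⊤ := (h1 1 one_pos).lt_top
  have h2' : ∫⁻ s in {s | 1 ≤ h s} ∩ Ici 0, ENNReal.ofReal (1 / √(h s)) < ⊤ := by
    rcases h2 with ⟨M, hM, h3⟩ | h3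
    · exact absurd (top_le_iff.1 h3) (h1 M hM)
    · exact (h3 1 one_pos).lt_top
  refine ⟨hcont.aestronglyMeasurable, ?_⟩
  rw [hasFiniteIntegral_iff_ofReal (.of_forall fun s ↦ by positivity)]
  have hcover : Ioi (0 : ℝ) ⊆ ({s | h s ≤ 1} ∩ Ici 0) ∪ ({s | 1 ≤ h s} ∩ Ici 0) := by
    intro y hy
    rcases le_total (h y) 1 with h3 | h3
    · exact .inl ⟨h3, (mem_Ioi.1 hy).le⟩
    · exact .inr ⟨h3, (mem_Ioi.1 hy).le⟩
  refine (lintegral_mono_set hcover).trans_lt ((lintegral_union_le _ _ _).trans_lt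
    (ENNReal.add_lt_top.2 ⟨?_, ?_⟩))
  · refine lt_of_le_of_lt (setLIntegral_mono' (g := fun _ ↦ 1) ((isClosed_le hhc
      continuous_const).measurableSet.inter measurableSet_Ici) fun y hy ↦ ?_) ?_
    · rw [← ENNReal.ofReal_one]
      refine ENNReal.ofReal_le_ofReal (div_le_one_of_le₀ ?_ (Real.sqrt_nonneg _))
      exact Real.one_le_sqrt.2 (hpos y)
    · rw [setLIntegral_const, one_mul]
      exact h1'
  · refine lt_of_le_of_lt (setLIntegral_mono' ((isClosed_le continuous_const
      hhc).measurableSet.inter measurableSet_Ici) fun y hy ↦ ?_) h2'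
    have hy1 : (1 : ℝ) ≤ h y := hy.1
    exact ENNReal.ofReal_le_ofReal (one_div_le_one_div_of_le
      (Real.sqrt_pos.2 (zero_lt_one.trans_le hy1)) (Real.sqrt_le_sqrt (by linarith)))

/-- The motion with `p' = v(p)`: it is the inverse of the travel time `s ↦ ∫₀ˢ 1 / v`. It is defined
on an open interval `J`, which is bounded above if `1 / v` is integrable, and it is inverse to a map
`T : ℝ → J`. -/
theorem exists_motion {v : ℝ → ℝ} (hv : ContDiff ℝ ∞ v) (hpos : ∀ s, 0 < v s)
    (hint : IntegrableOn (fun s ↦ 1 / v s) (Ioi 0)) :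
    ∃ (T p : ℝ → ℝ) (J : Set ℝ), IsOpen J ∧ J.OrdConnected ∧ BddAbove J ∧ StrictMono T ∧
      range T = J ∧ (∀ s, p (T s) = s) ∧ ContDiffOn ℝ ∞ p J ∧
      ∀ t ∈ J, HasDerivAt p (v (p t)) t := by
  have hvc : Continuous fun s ↦ 1 / v s :=
    continuous_const.div hv.continuous fun s ↦ (hpos s).ne'
  let T : ℝ → ℝ := fun s ↦ ∫ z in (0 : ℝ)..s, 1 / v z
  have hT : ∀ s, HasDerivAt T (1 / v s) s := fun s ↦
    intervalIntegral.integral_hasDerivAt_right (hvc.intervalIntegrable _ _)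
      (hvc.stronglyMeasurableAtFilter _ _) hvc.continuousAt
  have hTmono : StrictMono T := strictMono_of_deriv_pos fun s ↦ by
    rw [(hT s).deriv]
    exact one_div_pos.2 (hpos s)
  have hTs : ContDiff ℝ ∞ T := by
    rw [contDiff_infty_iff_deriv]
    refine ⟨fun s ↦ (hT s).differentiableAt, ?_⟩
    rw [funext fun s ↦ (hT s).deriv]
    exact contDiff_const.div hv fun s ↦ (hpos s).ne'
  let p : ℝ → ℝ := Function.invFun T
  have hpT : ∀ s, p (T s) = s := Function.leftInverse_invFun hTmono.injective
  -- near each point `p` is a smooth local inverse of `T`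
  have hloc : ∀ s, ContDiffAt ℝ ∞ p (T s) ∧ ∀ᶠ t in 𝓝 (T s), T (p t) = t := by
    intro s
    let f' : ℝ ≃L[ℝ] ℝ := ContinuousLinearEquiv.unitsEquivAut ℝ
      (Units.mk0 (1 / v s) (one_div_pos.2 (hpos s)).ne')
    have hf' : HasFDerivAt T (f' : ℝ →L[ℝ] ℝ) s :=
      (hT s).hasFDerivAt_equiv (one_div_pos.2 (hpos s)).ne'
    have hn : (∞ : WithTop ℕ∞) ≠ 0 := by simp
    have h1 := hTs.contDiffAt.to_localInverse hf' hn
    have h2 : ∀ᶠ t in 𝓝 (T s), T (hTs.contDiffAt.localInverse hf' hn t) = t :=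
      (hTs.contDiffAt.hasStrictFDerivAt' hf' hn).eventually_right_inverse
    have h3 : p =ᶠ[𝓝 (T s)] hTs.contDiffAt.localInverse hf' hn := by
      filter_upwards [h2] with t ht
      conv_lhs => rw [← ht]
      exact hpT _
    refine ⟨h1.congr_of_eventuallyEq h3, ?_⟩
    filter_upwards [h2] with t ht
    conv_lhs => rw [← ht, hpT]
    exact ht
  refine ⟨T, p, range T, ?_, ?_, ?_, hTmono, rfl, hpT, ?_, ?_⟩
  · rw [isOpen_iff_mem_nhds]
    rintro _ ⟨s, rfl⟩
    filter_upwards [(hloc s).2] with t ht using ⟨p t, ht⟩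
  · exact (isPreconnected_range hTs.continuous).ordConnected
  · refine ⟨∫ z in Ioi 0, 1 / v z, ?_⟩
    rintro _ ⟨s, rfl⟩
    have h1 : T s ≤ T (max s 0) := hTmono.monotone (le_max_left _ _)
    have h2 : T (max s 0) = ∫ z in Ioc 0 (max s 0), 1 / v z :=
      intervalIntegral.integral_of_le (le_max_right _ _)
    rw [h2] at h1
    refine h1.trans (setIntegral_mono_set hint
      (.of_forall fun z ↦ (one_div_pos.2 (hpos z)).le) ?_)
    exact (Ioc_subset_Ioi_self).eventuallyLE
  · rintro _ ⟨s, rfl⟩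
    exact (hloc s).1.contDiffWithinAt
  · rintro _ ⟨s, rfl⟩
    have h1 := HasDerivAt.of_local_left_inverse (f := T) (g := p) (a := T s) (f' := 1 / v s)
      (hloc s).1.continuousAt (by rw [hpT]; exact hT s) (one_div_pos.2 (hpos s)).ne' (hloc s).2
    simpa [hpT] using h1

end Analysis

/-! ### Geodesics which cross a ribbon -/

section Surface

variable {X : Type*} [TopologicalSpace X] [ChartedSpace Plane X] [IsManifold (𝓡 2) ∞ X]
  {g : LorentzianMetric X} {K : ∀ p : X, TangentSpace (𝓡 2) p} {φ : ℝ → X → X}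
  {x : X → ℝ} {σ : ℝ} {c : ℝ → X}

/-- A geodesic of type `ε` which reaches infinity in the ribbon in finite time contradicts the
analytic condition: `D = ⟨γ', K⟩²` and `E = ε ⟨γ', γ'⟩` are constant, and
`(x ∘ γ)'² = D + E (-ε f)` as long as `γ` stays in the ribbon. -/
theorem TraversesRibbon.not_conditionCR (h : IsKillingFlow g K φ)
    (hx : IsTransverseCoordinate g K x) {R : Set X} {f : ℝ → ℝ}
    (hf : ∀ p ∈ R, g.val p (K p) (K p) = f (x p)) (hfc : Continuous f) {ε : ℝ} (hε : ε ^ 2 = 1)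
    {γ : ℝ → X} {J : Set ℝ} (hγ : TraversesRibbon g x R ε γ J) (hJ : BddAbove J) :
    ¬ ConditionCR ε f := by
  obtain ⟨⟨hgeo, -⟩, htype, t₀, ht₀, hin, hunb⟩ := hγ
  have hint := integrableOn_of_bddAbove (h := fun s ↦ -ε * f s) (u := fun t ↦ x (γ t))
    (w := fun t ↦ coordDeriv x (γ t) (velocity γ t)) (J := J ∩ Ici t₀) (t₀ := t₀)
    (D := momentum g K γ t₀ ^ 2) (E := ε * normSqVelocity g γ t₀) (continuous_const.mul hfc)
    (hgeo.ordConnected.inter ordConnected_Ici) ⟨ht₀, self_mem_Ici⟩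
    (fun t ht ↦ hasDerivAt_comp_curve (hx.mdifferentiableAt _)
      ((hgeo.contMDiffOn.contMDiffAt (hgeo.isOpen.mem_nhds ht.1)).mdifferentiableAt (by simp)))
    (fun t ht ↦ by
      rw [hx.coordDeriv_velocity_sq, hf _ (hin t ht.1 ht.2), h.momentum_eq hgeo ht.1 ht₀,
        hgeo.normSqVelocity_eq ht.1 ht₀]
      linear_combination (-(f (x (γ t)) * normSqVelocity g γ t₀)) * hε.symm)
    (by rwa [inter_assoc, inter_self]) (hJ.mono inter_subset_left)
  exact not_conditionCR_of_integrableOn hfc (htype t₀ ht₀) hint.1 hint.2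

/-- A geodesic on which the coordinate `x` takes all real values, monotonically, cannot be
extended: `x` would be bounded near an additional endpoint. -/
theorem IsGeodesicOn.isMaximalGeodesic {γ : ℝ → X} {J : Set ℝ} (hγ : IsGeodesicOn g γ J)
    (hx : Continuous x) {T : ℝ → ℝ} (hT : StrictMono T) (hTJ : range T = J)
    (hxT : ∀ s, x (γ (T s)) = s) : IsMaximalGeodesic g γ J := by
  refine ⟨hγ, fun γ' J' hγ' hsub heq ↦ (Subset.antisymm hsub fun t₁ ht₁ ↦ ?_).symm⟩
  by_contra hn
  have hTm : ∀ s, T s ∈ J := fun s ↦ hTJ ▸ mem_range_self s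
  have hcont : ContinuousOn (fun t ↦ x (γ' t)) (uIcc (T 0) t₁) :=
    hx.comp_continuousOn
      (hγ'.contMDiffOn.continuousOn.mono (hγ'.ordConnected.uIcc_subset (hsub (hTm 0)) ht₁))
  have hxs : ∀ s, x (γ' (T s)) = s := fun s ↦ by rw [← heq (hTm s), hxT]
  rcases le_total (T 0) t₁ with h0 | h0
  · obtain ⟨b, hb⟩ := isCompact_uIcc.bddAbove_image hcont
    have h1 : T 0 ≤ T (max 0 (b + 1)) := hT.monotone (le_max_left _ _)
    have h2 : T (max 0 (b + 1)) ≤ t₁ := by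
      by_contra! h3
      exact hn (hγ.ordConnected.out (hTm 0) (hTm _) ⟨h0, h3.le⟩)
    have h4 := hb (mem_image_of_mem _ (mem_uIcc_of_le h1 h2))
    simp only [hxs] at h4
    linarith [le_max_right 0 (b + 1)]
  · obtain ⟨b, hb⟩ := isCompact_uIcc.bddBelow_image hcont
    have h1 : T (min 0 (b - 1)) ≤ T 0 := hT.monotone (min_le_left _ _)
    have h2 : t₁ ≤ T (min 0 (b - 1)) := by
      by_contra! h3
      exact hn (hγ.ordConnected.out (hTm _) (hTm 0) ⟨h3.le, h0⟩)
    have h4 := hb (mem_image_of_mem _ (mem_uIcc_of_ge h2 h1))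
    simp only [hxs] at h4
    linarith [min_le_right 0 (b - 1)]

/-- A solution `p` of `p' = v(p)`, where `v² = C² - ε ⟨K, K⟩`, lifts to a geodesic `γ` with
`⟨γ', γ'⟩ = ε` and `⟨γ', K⟩ = σ C`. -/
theorem IsNullTransversalOn.exists_geodesic (hc : IsNullTransversalOn g K x σ c univ)
    (hσ : σ ^ 2 = 1) (h : IsKillingFlow g K φ) (hx : IsTransverseCoordinate g K x) {ε C : ℝ}
    (hε : ε ^ 2 = 1) (hC : 0 < C) {v : ℝ → ℝ} (hv : ContDiff ℝ ∞ v) (hpos : ∀ s, 0 < v s)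
    (hk : ∀ s, g.val (c s) (K (c s)) (K (c s)) = ε * (C ^ 2 - v s ^ 2)) {p : ℝ → ℝ} {J : Set ℝ}
    (hJ : IsOpen J) (hJc : J.OrdConnected) (hJn : J.Nonempty) (hp : ContDiffOn ℝ ∞ p J)
    (hpv : ∀ t ∈ J, HasDerivAt p (v (p t)) t) :
    ∃ γ : ℝ → X, IsGeodesicOn g γ J ∧ (∀ t, γ t ∈ range (flowMap φ c)) ∧
      (∀ t ∈ J, normSqVelocity g γ t = ε) ∧ ∀ t, x (γ t) = p t := by
  have hCv : ∀ s, C + v s ≠ 0 := fun s ↦ (add_pos hC (hpos s)).ne'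
  have hv0 : ∀ s, v s ≠ 0 := fun s ↦ (hpos s).ne'
  -- the flow time along the geodesic, as a function of the transverse coordinate
  let y : ℝ → ℝ := fun s ↦ σ * ε / ((C + v s) * v s)
  have hys : ContDiff ℝ ∞ y := contDiff_const.div ((contDiff_const.add hv).mul hv) fun s ↦
    mul_ne_zero (hCv s) (hv0 s)
  let Y : ℝ → ℝ := fun s ↦ ∫ z in (0 : ℝ)..s, y z
  have hY : ∀ s, HasDerivAt Y (y s) s := fun s ↦
    intervalIntegral.integral_hasDerivAt_right (hys.continuous.intervalIntegrable _ _)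
      (hys.continuous.stronglyMeasurableAtFilter _ _) hys.continuous.continuousAt
  have hYs : ContDiff ℝ ∞ Y := by
    rw [contDiff_infty_iff_deriv]
    refine ⟨fun s ↦ (hY s).differentiableAt, ?_⟩
    rwa [funext fun s ↦ (hY s).deriv]
  have hvd : ∀ s, HasDerivAt v (deriv v s) s := fun s ↦
    (hv.differentiable (by simp) s).hasDerivAt
  have hvp : ∀ t ∈ J, HasDerivAt (fun t ↦ v (p t)) (deriv v (p t) * v (p t)) t := fun t ht ↦
    (hvd (p t)).comp t (hpv t ht)
  have hp₂ : ∀ t ∈ J, HasDerivAt (fun t ↦ Y (p t)) (σ * ε / (C + v (p t))) t := by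
    intro t ht
    have h1 := (hY (p t)).comp t (hpv t ht)
    have h2 : y (p t) * v (p t) = σ * ε / (C + v (p t)) := by
      have h3 := hCv (p t)
      have h4 := hv0 (p t)
      simp only [y]
      field_simp
    rwa [h2] at h1
  have hkd : ∀ s, deriv (fun s ↦ g.val (c s) (K (c s)) (K (c s))) s
      = ε * (-(2 * v s * deriv v s)) := by
    intro s
    rw [funext hk]
    have h1 := (((hvd s).pow 2).const_sub (C ^ 2)).const_mul ε
    simpa using h1.deriv
  have hgeo := hc.isGeodesicOn hσ h isOpen_univ hJ hJc hJn (p₁ := p) (p₂ := fun t ↦ Y (p t))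
    (v₁ := fun t ↦ v (p t)) (v₂ := fun t ↦ σ * ε / (C + v (p t))) hp
    (hYs.comp_contDiffOn hp) (mapsTo_univ _ _) hpv hp₂ (fun t ht ↦ by
      have h1 : (fun t ↦ σ * v (p t)
          + g.val (c (p t)) (K (c (p t))) (K (c (p t))) * (σ * ε / (C + v (p t))))
          = fun _ ↦ σ * C := by
        funext s
        have h3 := hCv (p s)
        rw [hk]
        field_simp
        linear_combination (σ * (C ^ 2 - v (p s) ^ 2)) * hε
      rw [h1]
      exact hasDerivAt_const _ _) (fun t ht ↦ by
      have h1 := (hasDerivAt_const t (σ * ε)).div ((hvp t ht).const_add C) (hCv (p t))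
      refine h1.congr_deriv ?_
      have h3 := hCv (p t)
      rw [hkd]
      field_simp
      linear_combination (σ * ε * deriv v (p t) * v (p t)) * (ε ^ 2 * hσ + hε))
  refine ⟨_, hgeo, fun t ↦ mem_range_self _, fun t ht ↦ ?_, fun t ↦ hc.coord_flowMap h hx _⟩
  have hΦ : MDifferentiableAt 𝓘(ℝ, ℝ × ℝ) (𝓡 2) (flowMap φ c) (p t, Y (p t)) :=
    (hc.contMDiff_flowMap h).mdifferentiable (by simp) _
  have h1 := pullMetric_comp g (P := fun t ↦ (p t, Y (p t))) hΦ
    ((hpv t ht).prodMk (hp₂ t ht)).hasFDerivAt 1 1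
  rw [hc.pullMetric_flowMap h isOpen_univ (mem_univ _)] at h1
  refine Eq.trans (b := pullMetric g (fun t ↦ flowMap φ c (p t, Y (p t))) t 1 1) rfl (h1.trans ?_)
  have h3 := hCv (p t)
  simp only [hk, ContinuousLinearMap.toSpanSingleton_apply, one_smul]
  field_simp
  linear_combination ε * (2 * v (p t) * (C + v (p t)) + ε ^ 2 * (C ^ 2 - v (p t) ^ 2)) * hσ
    + ε * (C ^ 2 - v (p t) ^ 2) * hε

/-- If the analytic condition fails, there is an incomplete geodesic of type `ε` crossing the
ribbon. -/
theorem IsNullTransversalOn.exists_traversesRibbon (hc : IsNullTransversalOn g K x σ c univ)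
    (hσ : σ ^ 2 = 1) (h : IsKillingFlow g K φ) (hx : IsTransverseCoordinate g K x) {f : ℝ → ℝ}
    (hf : ∀ s, g.val (c s) (K (c s)) (K (c s)) = f s) (hfs : ContDiff ℝ ∞ f) {ε : ℝ}
    (hε : ε ^ 2 = 1) (hb : BddBelow (range fun s ↦ -ε * f s)) (hCR : ¬ ConditionCR ε f) :
    ∃ (γ : ℝ → X) (J : Set ℝ), TraversesRibbon g x (range (flowMap φ c)) ε γ J ∧ BddAbove J := by
  obtain ⟨b, hb⟩ := hb
  have hb' : ∀ s, b ≤ -ε * f s := fun s ↦ hb (mem_range_self s)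
  -- the momentum is chosen so large that the radicand below is at least `1`
  let C : ℝ := |b| + 1
  have hC : 0 < C := by positivity
  have hpos : ∀ s, 1 ≤ C ^ 2 + -ε * f s := by
    intro s
    have h1 : C ^ 2 = |b| ^ 2 + 2 * |b| + 1 := by ring
    linarith [hb' s, neg_abs_le b, sq_nonneg |b|, abs_nonneg b]
  have hrad : ∀ s, 0 < C ^ 2 + -ε * f s := fun s ↦ zero_lt_one.trans_le (hpos s)
  let v : ℝ → ℝ := fun s ↦ √(C ^ 2 + -ε * f s)
  have hv : ContDiff ℝ ∞ v :=
    (contDiff_const.add (contDiff_const.mul hfs)).sqrt fun s ↦ (hrad s).ne'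
  have hv0 : ∀ s, 0 < v s := fun s ↦ Real.sqrt_pos.2 (hrad s)
  obtain ⟨T, p, J, hJ, hJc, hJb, hT, hTJ, hpT, hp, hpv⟩ := exists_motion hv hv0
    (integrableOn_of_not_conditionCR hfs.continuous (sq_nonneg C) hpos hCR)
  have hTm : ∀ s, T s ∈ J := fun s ↦ hTJ ▸ mem_range_self s
  obtain ⟨γ, hγ, hγR, hγε, hγx⟩ := hc.exists_geodesic hσ h hx hε hC hv hv0 (fun s ↦ by
    rw [hf, Real.sq_sqrt (hrad s).le]
    linear_combination (-f s) * hε) hJ hJc ⟨_, hTm 0⟩ hp hpv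
  have hxT : ∀ s, x (γ (T s)) = s := fun s ↦ by rw [hγx, hpT]
  refine ⟨γ, J, ⟨hγ.isMaximalGeodesic hx.1.continuous hT hTJ hxT, fun t ht ↦ ?_, T 0, hTm 0,
    fun t _ _ ↦ hγR t, ?_⟩, hJb⟩
  · rw [hγε t ht, ← sq, hε]
    exact one_pos
  · rw [not_bddAbove_iff]
    intro r
    refine ⟨_, ⟨T (max 0 (r + 1)), ⟨hTm _, hT.monotone (le_max_left _ _)⟩, rfl⟩, ?_⟩
    simp only [hxT]
    linarith [le_max_right 0 (r + 1)]

end Surface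

theorem conditionCR_of_bounded {ε : ℝ} (hε : ε = 1 ∨ ε = -1) {f : ℝ → ℝ} {B : ℝ}
    (hB : ∀ s, |f s| ≤ B) : ConditionCR ε f := by
  refine .inl ⟨max B 1, zero_lt_one.trans_le (le_max_right _ _), ?_⟩
  have h1 : ∀ s, -ε * f s ≤ max B 1 := by
    intro s
    refine le_trans ?_ (le_max_left _ _)
    rcases hε with rfl | rfl
    · linarith [neg_abs_le (f s), hB s]
    · linarith [le_abs_self (f s), hB s]
  have h2 : {s : ℝ | -ε * f s ≤ max B 1} = univ := eq_univ_of_forall h1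
  rw [h2, univ_inter, Real.volume_Ici]

theorem mainTheorem4 {X : Type*} [TopologicalSpace X] [T2Space X] [SecondCountableTopology X]
    [ChartedSpace Plane X] [IsManifold (𝓡 2) ∞ X] [SimplyConnectedSpace X]
    (g : LorentzianMetric X) (hg : IsNullComplete g)
    (K : ∀ p : X, TangentSpace (𝓡 2) p) (hK : IsCompleteKillingField g K)
    (x : X → ℝ) (hx : IsTransverseCoordinate g K x)
    (R : Set X) (hR : IsMaximalRibbon g K R)
    (f : ℝ → ℝ) (hf : ∀ p ∈ R, g.val p (K p) (K p) = f (x p))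
    (ε : ℝ) (hε : ε = 1 ∨ ε = -1) :
    (BddBelow (range fun s ↦ -ε * f s) → ¬ BddAbove (range fun s ↦ -ε * f s) →
      ((∀ (γ : ℝ → X) (J : Set ℝ), TraversesRibbon g x R ε γ J → ¬ BddAbove J) ↔
        ConditionCR ε f)) ∧
    ((∃ B : ℝ, ∀ s, |f s| ≤ B) →
      ∀ (γ : ℝ → X) (J : Set ℝ), TraversesRibbon g x R ε γ J → ¬ BddAbove J) := by
  obtain ⟨φ, h⟩ := hK.exists_flow
  obtain ⟨σ, c, hσ, hc, rfl⟩ := hR.exists_eq_range h hx hg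
  have hε2 : ε ^ 2 = 1 := by rcases hε with rfl | rfl <;> norm_num
  have hk : ∀ s, g.val (c s) (K (c s)) (K (c s)) = f s := by
    intro s
    have hm : c s ∈ range (flowMap φ c) := ⟨(s, 0), by simp [flowMap, h.map_zero]⟩
    rw [hf _ hm, hc.coord_eq s (mem_univ s)]
  have hfs : ContDiff ℝ ∞ f := by
    have h1 := h.contDiffOn_field isOpen_univ hc.contMDiffOn
    rwa [funext hk, contDiffOn_univ] at h1
  have hcomplete : ConditionCR ε f →
      ∀ (γ : ℝ → X) (J : Set ℝ), TraversesRibbon g x (range (flowMap φ c)) ε γ J → ¬ BddAbove J :=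
    fun hCR γ J hγ hJ ↦ hγ.not_conditionCR h hx hf hfs.continuous hε2 hJ hCR
  refine ⟨fun hb _ ↦ ⟨fun hall ↦ ?_, hcomplete⟩, fun ⟨B, hB⟩ ↦
    hcomplete (conditionCR_of_bounded hε hB)⟩
  by_contra hCR
  obtain ⟨γ, J, hγ, hJ⟩ := hc.exists_traversesRibbon hσ h hx hk hfs hε2 hb hCR
  exact hall γ J hγ hJ
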